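/- Let $n\ge 1$, $s\ge 1$, and let $M$ be a (nonempty) smooth manifold of dimension $2n+s$ with a weak metric $f$-structure $(f,Q,\xi_i,\eta^i,g)$, $1\le i\le s$: $g$ is a Riemannian metric, $f$ is a skew-symmetric $(1,1)$-tensor of rank $2n$, $Q$ is a self-adjoint nonsingular $(1,1)$-tensor, the $\xi_i$ are orthonormal vector fields and the $\eta^i$ are $1$-forms (all of these being smooth), such that $$f^2=-Q+\sum_i\eta^i\otimes\xi_i,\qquad \eta^i(\xi_j)=\delta^i_j,\qquad Q\xi_i=\xi_i,\qquad g(fX,fY)=g(X,QY)-\sum_i\eta^i(X)\,\eta^i(Y)$$ for all vector fields $X,Y$, and such that the distribution $\bigcap_i\ker\eta^i$ is $f$-invariant. Put $\bar\xi=\sum_i\xi_i$ and $\bar\eta=\sum_i\eta^i$, and let $\nabla$ be the Levi-Civita connection of $g$, with curvature $R_{X,Y}=[\nabla_X,\nabla_Y]-\nabla_{[X,Y]}$. Suppose that $M$ is a weak $\beta f$-Kenmotsu manifold for a constant $\beta\neq 0$, that is, $$(\nabla_X f)Y=\beta\{g(fX,Y)\,\bar\xi-\bar\eta(Y)\,fX\}$$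 for all vector fields $X,Y$. Define the $*$-Ricci tensor by $\mathrm{Ric}^*(X,Y)=\tfrac12\,\mathrm{trace}\{Z\mapsto fR_{X,fY}Z\}$. Let $V$ be a smooth vector field and $\lambda,\mu\in\mathbb R$ be such that $(g,V)$ is a $*$-$\eta$-Ricci soliton, that is, $$\tfrac12\,\mathcal L_Vg+\mathrm{Ric}^*=\lambda\Big\{g-\sum_i\eta^i\otimes\eta^i\Big\}+(\lambda+\mu)\,\bar\eta\otimes\bar\eta .$$ Then $\lambda+\mu=0$. -/

import Mathlib

open Bundle Manifold
open scoped ContDiff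

namespace WeakKenmotsu

noncomputable section

set_option linter.unusedSectionVars false

variable {E : Type*} [NormedAddCommGroup E] [NormedSpace ℝ E] [FiniteDimensional ℝ E]
  {H : Type*} [TopologicalSpace H] (I : ModelWithCorners ℝ E H)
  {M : Type*} [TopologicalSpace M] [ChartedSpace H M] [IsManifold I ∞ M]
  [RiemannianBundle (fun x : M ↦ TangentSpace I x)]
  [IsContMDiffRiemannianBundle I ∞ E (fun x : M ↦ TangentSpace I x)]

/-- The right-hand side of the Koszul formula: half of
`X g(Y, Z) + Y g(X, Z) - Z g(X, Y) + g([X, Y], Z) - g([X, Z], Y) - g([Y, Z], X)`, at `x`. -/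
def koszul (Y X Z : Π x : M, TangentSpace I x) (x : M) : ℝ :=
  (1 / 2) * (d% (fun y ↦ inner ℝ (Y y) (Z y)) x (X x)
    + d% (fun y ↦ inner ℝ (X y) (Z y)) x (Y x)
    - d% (fun y ↦ inner ℝ (X y) (Y y)) x (Z x)
    + inner ℝ (VectorField.mlieBracket I X Y x) (Z x)
    - inner ℝ (VectorField.mlieBracket I X Z x) (Y x)
    - inner ℝ (VectorField.mlieBracket I Y Z x) (X x))

variable {I}

theorem mdiff_inner {X Y : Π x : M, TangentSpace I x} {x : M}
    (hX : MDiffAt (T% X) x) (hY : MDiffAt (T% Y) x) :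
    MDiffAt (fun y ↦ inner ℝ (X y) (Y y)) x :=
  MDifferentiableAt.inner_bundle (IB := I) (F := E) (E := fun x : M ↦ TangentSpace I x) hX hY

theorem koszul_tensorial_dir {Y Z : Π x : M, TangentSpace I x} {x : M}
    (hY : MDiffAt (T% Y) x) (hZ : MDiffAt (T% Z) x) :
    TensorialAt I E (fun X ↦ koszul I Y X Z x) x where
  smul {f X} hf hX := by
    have : CompleteSpace E := FiniteDimensional.complete ℝ E
    simp [koszul, VectorField.mlieBracket_smul_left hf hX,
      mvfderiv_fun_mul hf (mdiff_inner hX hZ), mvfderiv_fun_mul hf (mdiff_inner hX hY),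
      inner_add_left, inner_smul_left, inner_smul_right]
    try ring
  add {X X'} hX hX' := by
    have : CompleteSpace E := FiniteDimensional.complete ℝ E
    simp [koszul, VectorField.mlieBracket_add_left hX hX',
      mvfderiv_fun_add (mdiff_inner hX hZ) (mdiff_inner hX' hZ),
      mvfderiv_fun_add (mdiff_inner hX hY) (mdiff_inner hX' hY),
      inner_add_left, inner_add_right]
    try ring

theorem koszul_tensorial_test {Y X : Π x : M, TangentSpace I x} {x : M}
    (hY : MDiffAt (T% Y) x) (hX : MDiffAt (T% X) x) :
    TensorialAt I E (fun Z ↦ koszul I Y X Z x) x where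
  smul {f Z} hf hZ := by
    have : CompleteSpace E := FiniteDimensional.complete ℝ E
    simp [koszul, VectorField.mlieBracket_smul_right hf hZ,
      mvfderiv_fun_mul hf (mdiff_inner hX hZ), mvfderiv_fun_mul hf (mdiff_inner hY hZ),
      inner_add_left, inner_smul_left, inner_smul_right]
    rw [real_inner_comm (Z x) (Y x), real_inner_comm (Z x) (X x)]
    try ring
  add {Z Z'} hZ hZ' := by
    have : CompleteSpace E := FiniteDimensional.complete ℝ E
    simp [koszul, VectorField.mlieBracket_add_right hZ hZ',
      mvfderiv_fun_add (mdiff_inner hX hZ) (mdiff_inner hX hZ'),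
      mvfderiv_fun_add (mdiff_inner hY hZ) (mdiff_inner hY hZ'),
      inner_add_left, inner_add_right]
    try ring


variable (I) in
theorem finiteDimensional_tangentSpace (x : M) : FiniteDimensional ℝ (TangentSpace I x) :=
  inferInstanceAs (FiniteDimensional ℝ E)

variable (I) in
theorem completeSpace_tangentSpace (x : M) : CompleteSpace (TangentSpace I x) :=
  have := finiteDimensional_tangentSpace I x
  FiniteDimensional.complete ℝ _

/-- The Koszul expression as a bilinear form on the tangent space. -/
def koszulForm (Y : Π x : M, TangentSpace I x) (x : M) (hY : MDiffAt (T% Y) x) :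
    TangentSpace I x →L[ℝ] TangentSpace I x →L[ℝ] ℝ :=
  TensorialAt.mkHom₂ (fun X Z ↦ koszul I Y X Z x) x
    (fun _ hZ ↦ koszul_tensorial_dir hY hZ) (fun _ hX ↦ koszul_tensorial_test hY hX)

theorem koszulForm_apply {X Y Z : Π x : M, TangentSpace I x} {x : M} (hX : MDiffAt (T% X) x)
    (hY : MDiffAt (T% Y) x) (hZ : MDiffAt (T% Z) x) :
    koszulForm Y x hY (X x) (Z x) = koszul I Y X Z x :=
  TensorialAt.mkHom₂_apply _ _ hX hZ

open Classical in
/-- `∇ Y` at `x` for the Levi-Civita connection of the metric: for a vector field `Y` that is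
differentiable at `x`, the vector `∇_u Y` is the one that represents the Koszul form. The value at
other fields is irrelevant. -/
def leviCivitaFun (Y : Π x : M, TangentSpace I x) (x : M) :
    TangentSpace I x →L[ℝ] TangentSpace I x :=
  have := finiteDimensional_tangentSpace I x
  have := completeSpace_tangentSpace I x
  if hY : MDiffAt (T% Y) x then
    LinearMap.toContinuousLinearMap
      { toFun := fun u ↦ (InnerProductSpace.toDual ℝ (TangentSpace I x)).symm (koszulForm Y x hY u)
        map_add' := by intro u v; simp
        map_smul' := by intro c v; simp }
  else 0

theorem inner_leviCivitaFun {X Y Z : Π x : M, TangentSpace I x} {x : M} (hX : MDiffAt (T% X) x)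
    (hY : MDiffAt (T% Y) x) (hZ : MDiffAt (T% Z) x) :
    inner ℝ (leviCivitaFun Y x (X x)) (Z x) = koszul I Y X Z x := by
  have := finiteDimensional_tangentSpace I x
  have := completeSpace_tangentSpace I x
  rw [← koszulForm_apply hX hY hZ]
  simp [leviCivitaFun, hY]

theorem inner_leviCivitaFun_extend {Y : Π x : M, TangentSpace I x} {x : M}
    (hY : MDiffAt (T% Y) x) (u w : TangentSpace I x) :
    inner ℝ (leviCivitaFun Y x u) w =
      koszul I Y (FiberBundle.extend E u) (FiberBundle.extend E w) x := by
  simpa using inner_leviCivitaFun (FiberBundle.mdifferentiableAt_extend I E u) hY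
    (FiberBundle.mdifferentiableAt_extend I E w)

variable (I M) in
/-- The Levi-Civita connection of a Riemannian manifold, as a covariant derivative on the tangent
bundle; `leviCivita I M Y x u` is `∇_u Y` for a tangent vector `u` at `x`. -/
def leviCivita : CovariantDerivative I E (fun x : M ↦ TangentSpace I x) where
  toFun := leviCivitaFun
  isCovariantDerivativeOnUniv :=
    { add := by
        intro Y Y' x hY hY' _
        have : CompleteSpace E := FiniteDimensional.complete ℝ E
        ext u
        refine ext_inner_right ℝ fun w ↦ ?_
        have hu := FiberBundle.mdifferentiableAt_extend I E u
        have hw := FiberBundle.mdifferentiableAt_extend I E w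
        rw [add_apply, inner_add_left, inner_leviCivitaFun_extend (mdifferentiableAt_add_section hY hY'),
          inner_leviCivitaFun_extend hY, inner_leviCivitaFun_extend hY']
        simp [koszul, VectorField.mlieBracket_add_left hY hY',
          VectorField.mlieBracket_add_right hY hY',
          mvfderiv_fun_add (mdiff_inner hY hw) (mdiff_inner hY' hw),
          mvfderiv_fun_add (mdiff_inner hu hY) (mdiff_inner hu hY'),
          inner_add_left, inner_add_right]
        ring
      leibniz := by
        intro Y f x hY hf _
        have : CompleteSpace E := FiniteDimensional.complete ℝ E
        ext u
        refine ext_inner_right ℝ fun w ↦ ?_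
        have hu := FiberBundle.mdifferentiableAt_extend I E u
        have hw := FiberBundle.mdifferentiableAt_extend I E w
        rw [add_apply, inner_add_left, inner_leviCivitaFun_extend (hf.smul_section hY),
          smul_apply, inner_smul_left, inner_leviCivitaFun_extend hY]
        simp [koszul, VectorField.mlieBracket_smul_left hf hY,
          VectorField.mlieBracket_smul_right hf hY,
          mvfderiv_fun_mul hf (mdiff_inner hY hw), mvfderiv_fun_mul hf (mdiff_inner hu hY),
          inner_add_left, inner_smul_left, inner_smul_right]
        rw [real_inner_comm u (Y x)]
        ring }

theorem inner_leviCivita {X Y Z : Π x : M, TangentSpace I x} {x : M} (hX : MDiffAt (T% X) x)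
    (hY : MDiffAt (T% Y) x) (hZ : MDiffAt (T% Z) x) :
    inner ℝ (leviCivita I M Y x (X x)) (Z x) = koszul I Y X Z x :=
  inner_leviCivitaFun hX hY hZ

/-- The Levi-Civita connection is torsion free. -/
theorem leviCivita_sub_swap {X Y : Π x : M, TangentSpace I x} {x : M} (hX : MDiffAt (T% X) x)
    (hY : MDiffAt (T% Y) x) :
    leviCivita I M Y x (X x) - leviCivita I M X x (Y x) = VectorField.mlieBracket I X Y x := by
  refine ext_inner_right ℝ fun w ↦ ?_
  have hw := FiberBundle.mdifferentiableAt_extend I E w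
  have h₁ := inner_leviCivita hX hY hw
  have h₂ := inner_leviCivita hY hX hw
  rw [FiberBundle.extend_apply_self] at h₁ h₂
  rw [inner_sub_left, h₁, h₂]
  simp only [koszul, FiberBundle.extend_apply_self]
  rw [VectorField.mlieBracket_swap_apply (V := Y) (W := X), inner_neg_left]
  simp only [real_inner_comm (X _) (Y _)]
  ring

/-- The Levi-Civita connection is compatible with the metric. -/
theorem mvfderiv_inner_eq_leviCivita {X Y Z : Π x : M, TangentSpace I x} {x : M}
    (hX : MDiffAt (T% X) x) (hY : MDiffAt (T% Y) x) (hZ : MDiffAt (T% Z) x) :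
    d% (fun y ↦ inner ℝ (Y y) (Z y)) x (X x) =
      inner ℝ (leviCivita I M Y x (X x)) (Z x) + inner ℝ (Y x) (leviCivita I M Z x (X x)) := by
  rw [real_inner_comm (leviCivita I M Z x (X x)) (Y x), inner_leviCivita hX hY hZ,
    inner_leviCivita hX hZ hY]
  simp only [koszul]
  rw [VectorField.mlieBracket_swap_apply (V := Z) (W := Y), inner_neg_left]
  simp only [real_inner_comm (Y _) (Z _)]
  ring

/-- The curvature `R_{X,Y} Z = ∇_X ∇_Y Z - ∇_Y ∇_X Z - ∇_{[X,Y]} Z` of vector fields, at `x`. -/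
def curvature (X Y Z : Π x : M, TangentSpace I x) (x : M) : TangentSpace I x :=
  leviCivita I M (fun y ↦ leviCivita I M Z y (Y y)) x (X x)
    - leviCivita I M (fun y ↦ leviCivita I M Z y (X y)) x (Y x)
    - leviCivita I M Z x (VectorField.mlieBracket I X Y x)

/-- The curvature `R_{u,v} w` of tangent vectors at `x`, computed from extensions of the vectors to
vector fields that are smooth near `x`; by tensoriality the extensions do not matter. -/
def curvatureAt (x : M) (u v w : TangentSpace I x) : TangentSpace I x :=
  curvature (FiberBundle.extend E u) (FiberBundle.extend E v) (FiberBundle.extend E w) x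

/-- The `*`-Ricci tensor of a `(1,1)`-tensor `f`:
`Ric*(u, v) = (1/2) trace (w ↦ f R_{u, f v} w)`, the trace being computed in an orthonormal basis
of the tangent space. -/
def starRicci (f : Π x : M, TangentSpace I x →L[ℝ] TangentSpace I x) (x : M)
    (u v : TangentSpace I x) : ℝ :=
  have := finiteDimensional_tangentSpace I x
  (1 / 2) * ∑ i, inner ℝ (f x (curvatureAt x u (f x v) (stdOrthonormalBasis ℝ (TangentSpace I x) i)))
    (stdOrthonormalBasis ℝ (TangentSpace I x) i)

/-- The Lie derivative of the metric,
`(L_V g)(X, Y) = V g(X, Y) - g([V, X], Y) - g(X, [V, Y])`, at `x`. -/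
def lieDerivMetric (V X Y : Π x : M, TangentSpace I x) (x : M) : ℝ :=
  d% (fun y ↦ inner ℝ (X y) (Y y)) x (V x)
    - inner ℝ (VectorField.mlieBracket I V X x) (Y x)
    - inner ℝ (X x) (VectorField.mlieBracket I V Y x)

variable (I M) in
/-- A weak metric `f`-structure `(f, Q, ξ_i, η^i, g)`, `1 ≤ i ≤ s`, with `f` of rank `2n`, on a
Riemannian manifold `(M, g)`. The dimension `2n + s` of `M` is to be imposed separately. -/
structure WeakMetricFStructure (n s : ℕ) where
  /-- The `(1,1)`-tensor `f`. -/
  f : Π x : M, TangentSpace I x →L[ℝ] TangentSpace I x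
  /-- The `(1,1)`-tensor `Q`. -/
  Q : Π x : M, TangentSpace I x →L[ℝ] TangentSpace I x
  /-- The vector fields `ξ_i`. -/
  ξ : Fin s → Π x : M, TangentSpace I x
  /-- The `1`-forms `η^i`. -/
  η : Fin s → Π x : M, TangentSpace I x →L[ℝ] ℝ
  contMDiff_f : ContMDiff I (I.prod 𝓘(ℝ, E →L[ℝ] E)) ∞ (fun x ↦ TotalSpace.mk' (E →L[ℝ] E)
    (E := fun x : M ↦ TangentSpace I x →L[ℝ] TangentSpace I x) x (f x))
  contMDiff_Q : ContMDiff I (I.prod 𝓘(ℝ, E →L[ℝ] E)) ∞ (fun x ↦ TotalSpace.mk' (E →L[ℝ] E)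
    (E := fun x : M ↦ TangentSpace I x →L[ℝ] TangentSpace I x) x (Q x))
  contMDiff_ξ : ∀ i, CMDiff ∞ (T% (ξ i))
  contMDiff_η : ∀ i, ContMDiff I (I.prod 𝓘(ℝ, E →L[ℝ] ℝ)) ∞ (fun x ↦ TotalSpace.mk' (E →L[ℝ] ℝ)
    (E := fun x : M ↦ TangentSpace I x →L[ℝ] ℝ) x (η i x))
  f_skew : ∀ (x : M) (u v : TangentSpace I x), inner ℝ (f x u) v = -inner ℝ u (f x v)
  f_rank : ∀ x : M, Module.finrank ℝ (f x).range = 2 * n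
  Q_selfAdjoint : ∀ (x : M) (u v : TangentSpace I x), inner ℝ (Q x u) v = inner ℝ u (Q x v)
  Q_nonsingular : ∀ x : M, Function.Bijective (Q x)
  ξ_orthonormal : ∀ x : M, Orthonormal ℝ (fun i ↦ ξ i x)
  f_f : ∀ (x : M) (u : TangentSpace I x), f x (f x u) = -Q x u + ∑ i, η i x u • ξ i x
  η_ξ : ∀ (x : M) (i j : Fin s), η i x (ξ j x) = if i = j then 1 else 0
  Q_ξ : ∀ (x : M) (i : Fin s), Q x (ξ i x) = ξ i x
  inner_f_f : ∀ (x : M) (u v : TangentSpace I x),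
    inner ℝ (f x u) (f x v) = inner ℝ u (Q x v) - ∑ i, η i x u * η i x v
  /-- The distribution `⋂ ker η^i` is `f`-invariant. -/
  f_invariant : ∀ (x : M) (u : TangentSpace I x), (∀ i, η i x u = 0) → ∀ i, η i x (f x u) = 0

namespace WeakMetricFStructure

variable {n s : ℕ} (S : WeakMetricFStructure I M n s)

/-- The vector field `ξ̄`, the sum of the `ξ_i`. -/
def ξbar (x : M) : TangentSpace I x := ∑ i, S.ξ i x

/-- The `1`-form `η̄`, the sum of the `η^i`. -/
def ηbar (x : M) : TangentSpace I x →L[ℝ] ℝ := ∑ i, S.η i x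

/-- The weak `βf`-Kenmotsu condition
`(∇_X f) Y = β (g(f X, Y) ξ̄ - η̄(Y) f X)`, where `(∇_X f) Y = ∇_X (f Y) - f (∇_X Y)`. Both sides are
tensorial, so that it does not matter which of the (smooth, differentiable, global, local) vector
fields are used. -/
def IsWeakKenmotsu (β : ℝ) : Prop :=
  ∀ (x : M) (X Y : Π x : M, TangentSpace I x), MDiffAt (T% X) x → MDiffAt (T% Y) x →
    leviCivita I M (fun y ↦ S.f y (Y y)) x (X x) - S.f x (leviCivita I M Y x (X x)) =
      β • (inner ℝ (S.f x (X x)) (Y x) • S.ξbar x - S.ηbar x (Y x) • S.f x (X x))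

/-- The `*`-`η`-Ricci soliton equation
`(1/2) L_V g + Ric* = l (g - ∑ η^i ⊗ η^i) + (l + m) η̄ ⊗ η̄`. -/
def IsStarEtaRicciSoliton (V : Π x : M, TangentSpace I x) (l m : ℝ) : Prop :=
  ∀ (x : M) (X Y : Π x : M, TangentSpace I x), MDiffAt (T% X) x → MDiffAt (T% Y) x →
    (1 / 2) * lieDerivMetric V X Y x + starRicci S.f x (X x) (Y x) =
      l * (inner ℝ (X x) (Y x) - ∑ i, S.η i x (X x) * S.η i x (Y x))
        + (l + m) * (S.ηbar x (X x) * S.ηbar x (Y x))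

end WeakMetricFStructure

end

end WeakKenmotsu

/-- The algebra of vector fields on a Riemannian manifold: a Lie--Rinehart algebra `L` over `A`
with a symmetric bilinear form and a compatible torsion-free connection. The bracket is
`nab X Y - nab Y X`. -/
structure LeviCivitaAlgebra (A L : Type*) [CommRing A] [Algebra ℝ A] [AddCommGroup L]
    [Module A L] where
  D : L →ₗ[A] Derivation ℝ A A
  nab : L →ₗ[A] L →+ L
  g : L →ₗ[A] L →ₗ[A] A
  g_symm : ∀ X Y, g X Y = g Y X
  nab_smul : ∀ X (a : A) Y, nab X (a • Y) = D X a • Y + a • nab X Y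
  D_g : ∀ X Y Z, D X (g Y Z) = g (nab X Y) Z + g Y (nab X Z)
  D_bracket : ∀ X Y a, D (nab X Y - nab Y X) a = D X (D Y a) - D Y (D X a)
  jacobi : ∀ X Y Z, nab X (nab Y Z - nab Z Y) - nab (nab Y Z - nab Z Y) X =
    (nab (nab X Y - nab Y X) Z - nab Z (nab X Y - nab Y X)) +
      (nab Y (nab X Z - nab Z X) - nab (nab X Z - nab Z X) Y)

namespace LeviCivitaAlgebra

variable {A L : Type*} [CommRing A] [Algebra ℝ A] [AddCommGroup L] [Module A L]
  (K : LeviCivitaAlgebra A L)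

/-- The Lie bracket. -/
def br (X Y : L) : L := K.nab X Y - K.nab Y X

theorem br_def (X Y : L) : K.br X Y = K.nab X Y - K.nab Y X := rfl

theorem br_swap (X Y : L) : K.br X Y = -K.br Y X := by simp [br_def]

theorem D_br (X Y : L) (a : A) : K.D (K.br X Y) a = K.D X (K.D Y a) - K.D Y (K.D X a) :=
  K.D_bracket X Y a

theorem br_br (X Y Z : L) : K.br X (K.br Y Z) = K.br (K.br X Y) Z + K.br Y (K.br X Z) :=
  K.jacobi X Y Z

theorem br_smul_right (X : L) (a : A) (Y : L) :
    K.br X (a • Y) = K.D X a • Y + a • K.br X Y := by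
  simp only [br_def, K.nab_smul, map_smul, AddMonoidHom.smul_apply, smul_sub]; abel

theorem br_smul_left (a : A) (X Y : L) :
    K.br (a • X) Y = -K.D Y a • X + a • K.br X Y := by
  rw [br_swap, br_smul_right, K.br_swap Y X, neg_add, neg_smul, smul_neg, neg_neg]

/-- The curvature operator `R_{X,Y}`. -/
def R (X Y : L) : L →ₗ[A] L where
  toFun Z := K.nab X (K.nab Y Z) - K.nab Y (K.nab X Z) - K.nab (K.br X Y) Z
  map_add' Z W := by simp only [map_add]; abel
  map_smul' a Z := by
    simp only [K.nab_smul, map_add, K.D_br, RingHom.id_apply, sub_smul, smul_sub]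
    abel

theorem R_apply (X Y Z : L) :
    K.R X Y Z = K.nab X (K.nab Y Z) - K.nab Y (K.nab X Z) - K.nab (K.br X Y) Z := rfl

theorem R_swap (X Y Z : L) : K.R X Y Z = -K.R Y X Z := by
  rw [R_apply, R_apply, br_swap K Y X, map_neg, AddMonoidHom.neg_apply]; abel

theorem R_add_left (X X' Y Z : L) : K.R (X + X') Y Z = K.R X Y Z + K.R X' Y Z := by
  simp only [R_apply, br_def, map_add, map_sub, AddMonoidHom.add_apply, AddMonoidHom.sub_apply]; abel

theorem R_smul_left (a : A) (X Y Z : L) : K.R (a • X) Y Z = a • K.R X Y Z := by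
  simp only [R_apply, br_smul_left, K.nab_smul, map_add, map_smul, map_neg, AddMonoidHom.add_apply,
    AddMonoidHom.smul_apply, smul_sub, neg_smul, AddMonoidHom.neg_apply]
  abel

/-- The map `X ↦ R_{X,Y} Z`, as a linear map. -/
def RLeft (Y Z : L) : L →ₗ[A] L where
  toFun X := K.R X Y Z
  map_add' X X' := K.R_add_left X X' Y Z
  map_smul' a X := K.R_smul_left a X Y Z

theorem R_skew (X Y Z W : L) : K.g (K.R X Y Z) W = -K.g Z (K.R X Y W) := by
  have h1 := K.D_br X Y (K.g Z W)
  simp only [K.D_g, map_add] at h1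
  simp only [R_apply, map_sub, LinearMap.sub_apply]
  linear_combination -h1

theorem bianchi (X Y Z : L) : K.R X Y Z + K.R Y Z X + K.R Z X Y = 0 := by
  have h := K.br_br X Y Z
  simp only [R_apply, br_def, map_sub, AddMonoidHom.sub_apply] at h ⊢
  rw [← sub_eq_zero] at h
  rw [← h]
  abel

theorem second_bianchi (X Y Z W : L) :
    (K.nab X (K.R Y Z W) - K.R Y Z (K.nab X W) - K.R (K.br X Y) Z W) +
    (K.nab Y (K.R Z X W) - K.R Z X (K.nab Y W) - K.R (K.br Y Z) X W) +
    (K.nab Z (K.R X Y W) - K.R X Y (K.nab Z W) - K.R (K.br Z X) Y W) = 0 := by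
  have h : K.br (K.br X Y) Z + K.br (K.br Y Z) X + K.br (K.br Z X) Y = 0 := by
    rw [K.br_swap (K.br Y Z) X, K.br_br X Y Z, K.br_swap Z X, K.br_swap Y (K.br X Z)]
    simp only [br_def, map_neg, AddMonoidHom.neg_apply]
    abel
  have h' := congrArg (fun U ↦ K.nab U W) h
  simp only [map_add, AddMonoidHom.add_apply, map_zero, AddMonoidHom.zero_apply] at h'
  simp only [R_apply, map_sub]
  rw [← h']
  abel

theorem _root_.eq_of_two_mul_eq {A : Type*} [CommRing A] [Algebra ℝ A] {a b : A} (h : 2 * a = 2 * b) : a = b := by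
  have h2 : algebraMap ℝ A (1 / 2) * 2 = 1 := by
    rw [← map_ofNat (algebraMap ℝ A) 2, ← map_mul]; norm_num
  linear_combination algebraMap ℝ A (1 / 2) * h + (b - a) * h2

theorem R_pair (X Y Z W : L) : K.g (K.R X Y Z) W = K.g (K.R Z W X) Y := by
  have b (X Y Z W : L) : K.g (K.R X Y Z) W + K.g (K.R Y Z X) W + K.g (K.R Z X Y) W = 0 := by
    have h := congrArg (fun U ↦ K.g U W) (K.bianchi X Y Z)
    simpa using h
  have s (X Y Z W : L) : K.g (K.R X Y Z) W = -K.g (K.R Y X Z) W := by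
    rw [K.R_swap X Y Z, map_neg, LinearMap.neg_apply]
  have k (X Y Z W : L) : K.g (K.R X Y Z) W = -K.g (K.R X Y W) Z := by
    rw [R_skew, K.g_symm]
  apply eq_of_two_mul_eq
  linear_combination b Y Z X W + b Z X W Y + b X W Y Z + b W Y Z X - k Y Z X W - k Z X Y W
    - k X W Z Y - k W Y X Z - s W Z X Y - s Y X W Z + k X Y W Z - k Z W Y X

end LeviCivitaAlgebra

/-- The algebraic form of a weak `bf`-Kenmotsu structure: vector fields `ξ i` and an endomorphism
`f` over a Levi-Civita algebra. -/
structure KenmotsuAlgebra (A L ι : Type*) [CommRing A] [Algebra ℝ A] [AddCommGroup L]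
    [Module A L] [Fintype ι] [DecidableEq ι] extends LeviCivitaAlgebra A L where
  ξ : ι → L
  f : L →ₗ[A] L
  b : ℝ
  g_ξ : ∀ i j, g (ξ i) (ξ j) = if i = j then 1 else 0
  f_skew : ∀ X Y, g (f X) Y = -g X (f Y)
  f_ξ : ∀ i, f (ξ i) = 0
  eq_of_f_eq_zero : ∀ X, f X = 0 → X = ∑ i, g X (ξ i) • ξ i
  nab_f : ∀ X Y, nab X (f Y) - f (nab X Y) =
    algebraMap ℝ A b • (g (f X) Y • ∑ i, ξ i - g Y (∑ i, ξ i) • f X)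

namespace KenmotsuAlgebra

variable {A L ι : Type*} [CommRing A] [Algebra ℝ A] [AddCommGroup L] [Module A L] [Fintype ι]
  [DecidableEq ι] (K : KenmotsuAlgebra A L ι)

/-- The sum of the `ξ i`. -/
def T : L := ∑ i, K.ξ i

/-- The constant `b`, as an element of the algebra of functions. -/
def β : A := algebraMap ℝ A K.b

/-- The number of the `ξ i`, as an element of the algebra of functions. -/
def N (_K : KenmotsuAlgebra A L ι) : A := algebraMap ℝ A (Fintype.card ι)

/-- Horizontal fields: those orthogonal to all `ξ i`. -/
def Hor (X : L) : Prop := ∀ i, K.g X (K.ξ i) = 0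

@[simp] theorem D_β (X : L) : K.D X K.β = 0 := by simp [β]

@[simp] theorem D_N (X : L) : K.D X K.N = 0 := by simp only [N, Derivation.map_algebraMap]

variable {K}

theorem Hor.T {X : L} (hX : K.Hor X) : K.g X K.T = 0 := by
  simp [KenmotsuAlgebra.T, hX _]

theorem Hor.T' {X : L} (hX : K.Hor X) : K.g K.T X = 0 := by rw [K.g_symm, hX.T]

theorem Hor.ξ {X : L} (hX : K.Hor X) (i : ι) : K.g (K.ξ i) X = 0 := by rw [K.g_symm, hX]

variable (K)

theorem g_T_ξ (i : ι) : K.g K.T (K.ξ i) = 1 := by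
  simp [T, map_sum, LinearMap.sum_apply, K.g_ξ]

theorem g_ξ_T (i : ι) : K.g (K.ξ i) K.T = 1 := by rw [K.g_symm, g_T_ξ]

theorem g_T_T : K.g K.T K.T = K.N := by
  have h : K.g K.T K.T = ∑ i, K.g K.T (K.ξ i) := by rw [← map_sum, T]
  simp [h, g_T_ξ, N]

theorem f_T : K.f K.T = 0 := by simp [T, map_sum, K.f_ξ]

theorem hor_f (X : L) : K.Hor (K.f X) := fun i ↦ by simp [K.f_skew, K.f_ξ]

theorem f_skew' (X Y : L) : K.g X (K.f Y) = -K.g (K.f X) Y := by rw [K.f_skew, neg_neg]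

theorem nab_f_eq (X Y : L) : K.nab X (K.f Y) = K.f (K.nab X Y) +
    K.β • (K.g (K.f X) Y • K.T - K.g Y K.T • K.f X) :=
  sub_eq_iff_eq_add'.1 (K.nab_f X Y)

theorem f_nab_ξ (X : L) (j : ι) : K.f (K.nab X (K.ξ j)) = K.β • K.f X := by
  have h := K.nab_f_eq X (K.ξ j)
  rw [K.f_ξ, map_zero, K.f_skew, K.f_ξ, map_zero, neg_zero, zero_smul, g_ξ_T, one_smul, zero_sub,
    smul_neg] at h
  exact (add_neg_eq_zero.1 h.symm)

theorem g_nab_ξ {Y : L} (hY : K.Hor Y) (X : L) (j : ι) :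
    K.g (K.nab X (K.ξ j)) Y = K.β * K.g X Y := by
  have h := K.eq_of_f_eq_zero (K.nab X (K.ξ j) - K.β • X) (by simp [K.f_nab_ξ])
  have h2 := congrArg (fun U ↦ K.g U Y) h
  simp only [map_sum, LinearMap.sum_apply, map_smul, LinearMap.smul_apply, hY.ξ, mul_zero,
    Finset.sum_const_zero, map_sub, LinearMap.sub_apply, smul_eq_mul] at h2
  linear_combination h2

theorem g_nab_T {Y : L} (hY : K.Hor Y) (X : L) :
    K.g (K.nab X K.T) Y = K.N * K.β * K.g X Y := by
  simp [T, map_sum, LinearMap.sum_apply, K.g_nab_ξ hY, N, mul_assoc]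

theorem g_nab_ξ_swap (X : L) (i j : ι) :
    K.g (K.nab X (K.ξ i)) (K.ξ j) = -K.g (K.nab X (K.ξ j)) (K.ξ i) := by
  have h := K.D_g X (K.ξ i) (K.ξ j)
  rw [K.g_ξ] at h
  have h0 : K.D X (if i = j then 1 else 0) = 0 := by split_ifs <;> simp
  rw [h0, K.g_symm (K.ξ i)] at h
  linear_combination -h

theorem g_nab_ξ_T (X : L) (i : ι) :
    K.g (K.nab X (K.ξ i)) K.T = -K.g (K.nab X K.T) (K.ξ i) := by
  simp only [T, map_sum, LinearMap.sum_apply, K.g_nab_ξ_swap X i, Finset.sum_neg_distrib]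

theorem g_nab_T_T (X : L) : K.g (K.nab X K.T) K.T = 0 := by
  have h := K.D_g X K.T K.T
  rw [g_T_T, D_N, K.g_symm K.T] at h
  apply eq_of_two_mul_eq
  linear_combination -h

/-- The horizontal part of a field. -/
def horPart (X : L) : L := X - ∑ i, K.g X (K.ξ i) • K.ξ i

theorem hor_horPart (X : L) : K.Hor (K.horPart X) := fun j ↦ by
  simp [horPart, map_sum, LinearMap.sum_apply, K.g_ξ]

theorem g_nab_hor_ξ {Z : L} (hZ : K.Hor Z) (X : L) (j : ι) :
    K.g (K.nab X Z) (K.ξ j) = -(K.β * K.g X Z) := by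
  have h := K.D_g X Z (K.ξ j)
  rw [hZ, map_zero, K.g_symm Z, K.g_nab_ξ hZ] at h
  linear_combination -h

/-- The covariant derivative of a horizontal field: its vertical part is a multiple of `T`. -/
theorem nab_hor {Z : L} (hZ : K.Hor Z) (X : L) :
    K.nab X Z = K.horPart (K.nab X Z) - (K.β * K.g X Z) • K.T := by
  simp only [horPart, K.g_nab_hor_ξ hZ, neg_smul, Finset.sum_neg_distrib, ← Finset.smul_sum, T]
  abel

theorem g_nab_hor {Z : L} (hZ : K.Hor Z) (X W : L) (hW : ∀ Y, K.Hor Y → K.g W Y = 0) :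
    K.g W (K.nab X Z) = -(K.β * K.g X Z * K.g W K.T) := by
  rw [K.nab_hor hZ, map_sub, hW _ (K.hor_horPart _)]
  simp

/-- The failure of `∇ T` to be `b` times the identity on vertical fields. -/
def α (k : ι) : L →ₗ[A] A where
  toFun X := K.g (K.nab X K.T) (K.ξ k) + K.β * K.g X K.T
  map_add' X Y := by simp; ring
  map_smul' a X := by simp; ring

theorem α_apply (k : ι) (X : L) : K.α k X = K.g (K.nab X K.T) (K.ξ k) + K.β * K.g X K.T := rfl

theorem g_R_ξ {Z : L} (hZ : K.Hor Z) (X Y : L) (k : ι) : K.g (K.R X Y (K.ξ k)) Z =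
    -(K.β * (K.α k Y * K.g X Z - K.α k X * K.g Y Z)) := by
  have key (X Y : L) : K.g (K.nab X (K.nab Y (K.ξ k))) Z =
      K.β * K.g (K.nab X Y) Z - K.β * (K.g X Z * K.α k Y) := by
    have h1 := K.D_g X (K.nab Y (K.ξ k)) Z
    have h2 := K.D_g X Y Z
    have h3 : K.g (K.nab Y (K.ξ k) - K.β • Y) (K.nab X Z) = _ :=
      K.g_nab_hor hZ X (K.nab Y (K.ξ k) - K.β • Y) fun U hU ↦ by simp [K.g_nab_ξ hU]
    rw [K.g_nab_ξ hZ] at h1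
    simp only [Derivation.leibniz, smul_eq_mul, D_β, map_sub, LinearMap.sub_apply, map_smul,
      LinearMap.smul_apply, K.g_nab_ξ_T] at h1 h3
    rw [α_apply]
    linear_combination K.β * h2 - h1 - h3
  simp only [K.R_apply, map_sub, LinearMap.sub_apply, key, K.g_nab_ξ hZ]
  simp only [K.br_def, map_sub, LinearMap.sub_apply]
  ring

theorem α_sum (X : L) : ∑ k, K.α k X = K.N * K.β * K.g X K.T := by
  simp only [α_apply, Finset.sum_add_distrib, Finset.sum_const, ← map_sum]
  have := K.g_nab_T_T X
  rw [T] at this ⊢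
  rw [this]
  simp [N, mul_assoc]

theorem g_R_T {Z : L} (hZ : K.Hor Z) (X Y : L) : K.g (K.R X Y K.T) Z =
    -(K.N * K.β ^ 2 * (K.g Y K.T * K.g X Z - K.g X K.T * K.g Y Z)) := by
  have h : K.g (K.R X Y K.T) Z = ∑ k, K.g (K.R X Y (K.ξ k)) Z := by
    simp [T, map_sum, LinearMap.sum_apply]
  simp only [h, K.g_R_ξ hZ, Finset.sum_neg_distrib, ← Finset.mul_sum, Finset.sum_sub_distrib,
    ← Finset.sum_mul, α_sum]
  ring

theorem g_nab_ξ_T_symm {X : L} (hX : K.Hor X) (j k : ι) :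
    K.β * (K.g (K.nab (K.ξ j) K.T) (K.ξ k) - K.g (K.nab (K.ξ k) K.T) (K.ξ j)) * K.g X X = 0 := by
  have h := K.R_pair X (K.ξ j) (K.ξ k) X
  have h1 := K.g_R_ξ hX X (K.ξ j) k
  have h2 := K.g_R_ξ hX X (K.ξ k) j
  have h3 : K.g (K.R (K.ξ k) X X) (K.ξ j) = K.g (K.R X (K.ξ k) (K.ξ j)) X := by
    rw [K.R_swap, map_neg, LinearMap.neg_apply, K.R_skew, neg_neg, K.g_symm]
  rw [hX.ξ] at h1 h2
  simp only [α_apply, g_ξ_T, hX.T] at h1 h2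
  linear_combination h1 - h2 - h - h3

theorem nab_T_T_of_symm
    (h : ∀ j k, K.g (K.nab (K.ξ j) K.T) (K.ξ k) = K.g (K.nab (K.ξ k) K.T) (K.ξ j)) (Y : L) :
    K.g (K.nab K.T K.T) Y = 0 := by
  have hv (k : ι) : K.g (K.nab K.T K.T) (K.ξ k) = 0 := by
    have h1 : K.g (K.nab K.T K.T) (K.ξ k) = ∑ j, K.g (K.nab (K.ξ j) K.T) (K.ξ k) := by
      conv_lhs => rw [show K.nab K.T = K.nab (∑ j, K.ξ j) from rfl]
      simp [map_sum, LinearMap.sum_apply]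
    rw [h1, Finset.sum_congr rfl fun j _ ↦ h j k, ← map_sum]
    exact K.g_nab_T_T _
  have hh := K.g_nab_T (K.hor_horPart Y) K.T
  rw [(K.hor_horPart Y).T', mul_zero, horPart] at hh
  simpa [map_sum, hv] using hh

end KenmotsuAlgebra

namespace LeviCivitaAlgebra

variable {A L : Type*} [CommRing A] [Algebra ℝ A] [AddCommGroup L] [Module A L]

/-- A family of fields that is orthonormal to first order at the point where `ev` evaluates. -/
structure OrthonormalAt (K : LeviCivitaAlgebra A L) (ev : A →+* ℝ) {κ : Type*} [Fintype κ]
    (E : κ → L) : Prop where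
  expand : ∀ (φ : L →ₗ[A] A) (Z : L), ev (φ Z) = ∑ j, ev (K.g Z (E j)) * ev (φ (E j))
  D_g_eq_zero : ∀ X i j, ev (K.D X (K.g (E i) (E j))) = 0

variable {K : LeviCivitaAlgebra A L} {ev : A →+* ℝ} {κ : Type*} [Fintype κ] {E : κ → L}

theorem OrthonormalAt.sum_nab_eq_zero (hE : K.OrthonormalAt ev E) (F : L →ₗ[A] L) (X : L) :
    ∑ i, (ev (K.g (F (K.nab X (E i))) (E i)) + ev (K.g (F (E i)) (K.nab X (E i)))) = 0 := by
  have h1 (i : κ) : ev (K.g (F (K.nab X (E i))) (E i)) =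
      ∑ j, ev (K.g (K.nab X (E i)) (E j)) * ev (K.g (F (E j)) (E i)) :=
    hE.expand ((K.g.flip (E i)).comp F) (K.nab X (E i))
  have h2 (i : κ) : ev (K.g (F (E i)) (K.nab X (E i))) =
      ∑ j, ev (K.g (K.nab X (E i)) (E j)) * ev (K.g (F (E i)) (E j)) :=
    hE.expand (K.g (F (E i))) (K.nab X (E i))
  have h3 (i j : κ) : ev (K.g (K.nab X (E i)) (E j)) = -ev (K.g (K.nab X (E j)) (E i)) := by
    have h := hE.D_g_eq_zero X i j
    rw [K.D_g, map_add, K.g_symm (E i)] at h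
    linarith
  simp only [h1, h2, Finset.sum_add_distrib]
  rw [Finset.sum_comm, ← Finset.sum_add_distrib]
  refine Finset.sum_eq_zero fun i _ ↦ ?_
  rw [← Finset.sum_add_distrib]
  refine Finset.sum_eq_zero fun j _ ↦ ?_
  rw [h3 j i]; ring

/-- The Lie derivative of the metric. -/
def lieG (V X Y : L) : A := K.g (K.nab X V) Y + K.g (K.nab Y V) X

theorem lieG_eq (V X Y : L) : lieG (K := K) V X Y =
    K.D V (K.g X Y) - K.g (K.br V X) Y - K.g X (K.br V Y) := by
  rw [K.D_g, lieG, K.g_symm _ X]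
  simp only [br_def, map_sub, LinearMap.sub_apply]
  ring

theorem lieG_br (T V X Y : L) : lieG (K := K) (K.br T V) X Y =
    (K.D T (lieG (K := K) V X Y) - lieG (K := K) V (K.br T X) Y - lieG (K := K) V X (K.br T Y)) -
    (K.D V (lieG (K := K) T X Y) - lieG (K := K) T (K.br V X) Y -
      lieG (K := K) T X (K.br V Y)) := by
  simp only [lieG_eq, K.D_br, K.br_br T V, map_sub, map_add, LinearMap.add_apply]
  ring

end LeviCivitaAlgebra

namespace KenmotsuAlgebra

variable {A L ι : Type*} [CommRing A] [Algebra ℝ A] [AddCommGroup L] [Module A L] [Fintype ι]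
  [DecidableEq ι] (K : KenmotsuAlgebra A L ι) {ev : A →+* ℝ} {κ : Type*} [Fintype κ] {E : κ → L}

/-- The trace of `f R_{X,Y}`, computed in the family `E`. -/
def Θ (E : κ → L) (X Y : L) : A := ∑ i, K.g (K.f (K.R X Y (E i))) (E i)

theorem Θ_swap (X Y : L) : K.Θ E X Y = -K.Θ E Y X := by
  simp only [Θ, K.R_swap X Y, map_neg, LinearMap.neg_apply, Finset.sum_neg_distrib]

theorem Θ_neg_left (X Y : L) : K.Θ E (-X) Y = -K.Θ E X Y := by
  have h (Z : L) : K.R (-X) Y Z = -K.R X Y Z := map_neg (K.RLeft Y Z) X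
  simp only [Θ, h, map_neg, LinearMap.neg_apply, Finset.sum_neg_distrib]

theorem ev_Θ_ξ (hE : K.OrthonormalAt ev E) (X : L) (k : ι) :
    ev (K.Θ E (K.ξ k) (K.f X)) = 2 * ev (K.β * K.α k (K.f (K.f X))) := by
  have h1 (i : κ) : K.g (K.f (K.R (K.ξ k) (K.f X) (E i))) (E i) =
      K.β * (K.α k (K.f (E i)) * K.g (K.f X) (E i) +
        K.α k (E i) * K.g (K.f (K.f X)) (E i)) := by
    have h := K.g_R_ξ (K.hor_f X) (E i) (K.f (E i)) k
    rw [K.f_skew, K.R_pair]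
    rw [K.g_symm (E i) (K.f X), K.g_symm (K.f (E i)), K.f_skew' (K.f X)] at h
    linear_combination -h
  have h2 := hE.expand ((K.α k).comp K.f) (K.f X)
  have h3 := hE.expand (K.α k) (K.f (K.f X))
  simp only [LinearMap.comp_apply] at h2
  simp only [Θ, h1, map_sum, map_mul, map_add, ← Finset.mul_sum, Finset.sum_add_distrib]
  simp only [mul_comm (ev (K.α k _)), ← h2, ← h3]
  ring

theorem ev_D_Θ (hE : K.OrthonormalAt ev E) (X Y Z : L) :
    ev (K.D X (K.Θ E Y Z)) = 2 * ev (K.β * K.g (K.R Y Z K.T) (K.f X)) +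
      ∑ i, ev (K.g (K.f (K.nab X (K.R Y Z (E i)) - K.R Y Z (K.nab X (E i)))) (E i)) := by
  have h := hE.sum_nab_eq_zero (K.f.comp (K.R Y Z)) X
  have h1 (i : κ) : K.D X (K.g (K.f (K.R Y Z (E i))) (E i)) =
      K.g (K.f (K.nab X (K.R Y Z (E i)) - K.R Y Z (K.nab X (E i)))) (E i) +
      (K.g (K.f (K.R Y Z (K.nab X (E i)))) (E i) +
        K.g (K.f (K.R Y Z (E i))) (K.nab X (E i))) +
      K.β * (- K.g K.T (E i) * K.g (K.R Y Z (K.f X)) (E i) +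
        K.g (K.f X) (E i) * K.g (K.R Y Z K.T) (E i)) := by
    rw [K.D_g, K.nab_f_eq]
    have e1 := K.R_skew Y Z (E i) (K.f X)
    have e2 := K.R_skew Y Z (E i) K.T
    rw [K.g_symm] at e1
    rw [K.g_symm (E i)] at e1 e2
    simp only [map_sub, map_add, map_smul, LinearMap.sub_apply, LinearMap.add_apply,
      LinearMap.smul_apply, smul_eq_mul, e1, e2]
    ring
  have h2 := hE.expand (K.g (K.R Y Z K.T)) (K.f X)
  have h3 := hE.expand (K.g (K.R Y Z (K.f X))) K.T
  have h4 := K.R_skew Y Z (K.f X) K.T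
  rw [K.g_symm (K.f X)] at h4
  rw [h4, map_neg] at h3
  simp only [LinearMap.comp_apply, Finset.sum_add_distrib] at h
  simp only [Θ, map_sum, h1, map_add, map_mul, map_neg, Finset.sum_add_distrib, ← Finset.mul_sum,
    neg_mul, Finset.sum_neg_distrib, ← h2, ← h3]
  linear_combination h

theorem ev_d_Θ (hE : K.OrthonormalAt ev E) (X Y Z : L) :
    ev (K.D X (K.Θ E Y Z) - K.Θ E (K.br X Y) Z + (K.D Y (K.Θ E Z X) - K.Θ E (K.br Y Z) X) +
      (K.D Z (K.Θ E X Y) - K.Θ E (K.br Z X) Y)) =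
    2 * ev (K.β * (K.g (K.R Y Z K.T) (K.f X) + K.g (K.R Z X K.T) (K.f Y) +
      K.g (K.R X Y K.T) (K.f Z))) := by
  have h (i : κ) := congrArg (fun U ↦ ev (K.g (K.f U) (E i))) (K.second_bianchi X Y Z (E i))
  have h' := Finset.sum_congr rfl fun i (_ : i ∈ Finset.univ) ↦ h i
  simp only [map_add, map_sub, LinearMap.add_apply, LinearMap.sub_apply, map_zero,
    LinearMap.zero_apply, Finset.sum_add_distrib, Finset.sum_sub_distrib,
    Finset.sum_const_zero] at h'
  simp only [map_add, map_sub, K.ev_D_Θ hE, map_mul, mul_add, LinearMap.sub_apply,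
    Finset.sum_sub_distrib]
  simp only [Θ, map_sum]
  linear_combination h'

variable {K}

theorem Hor.br {X Y : L} (hX : K.Hor X) (hY : K.Hor Y) : K.Hor (K.br X Y) := fun i ↦ by
  rw [K.br_def, map_sub, LinearMap.sub_apply, K.g_nab_hor_ξ hX, K.g_nab_hor_ξ hY, K.g_symm X]
  ring

theorem nab_T_of_hor (hw : ∀ X, K.Hor X → K.Hor (K.nab X K.T)) {X : L} (hX : K.Hor X) :
    K.nab X K.T = (K.N * K.β) • X := by
  have h := K.eq_of_f_eq_zero (K.nab X K.T - (K.N * K.β) • X) (by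
    simp [T, map_sum, K.f_nab_ξ, N, mul_smul, ← Nat.cast_smul_eq_nsmul A])
  simpa [hw X hX _, hX _, sub_eq_zero] using h

theorem Hor.br_T (hw : ∀ X, K.Hor X → K.Hor (K.nab X K.T)) {X : L} (hX : K.Hor X) :
    K.Hor (K.br K.T X) := fun i ↦ by
  rw [K.br_def, map_sub, LinearMap.sub_apply, K.g_nab_hor_ξ hX, hw X hX, hX.T']
  simp

theorem br_T_f (hw : ∀ X, K.Hor X → K.Hor (K.nab X K.T)) {X : L} (hX : K.Hor X) :
    K.br K.T (K.f X) = K.f (K.br K.T X) := by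
  rw [K.br_def, K.br_def, K.nab_f_eq, nab_T_of_hor hw hX, nab_T_of_hor hw (K.hor_f X), K.f_T, hX.T]
  simp

theorem lieG_T (hw : ∀ X, K.Hor X → K.Hor (K.nab X K.T)) {Y : L} (hY : K.Hor Y) (X : L) :
    LeviCivitaAlgebra.lieG (K := K.toLeviCivitaAlgebra) K.T X Y = 2 * (K.N * K.β) * K.g X Y := by
  rw [LeviCivitaAlgebra.lieG, K.g_nab_T hY, nab_T_of_hor hw hY, K.g_symm X]
  simp; ring

/-- The Lie derivative along `T` of the trace form `Θ`, on horizontal fields. -/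
theorem ev_lie_T_Θ (hE : K.OrthonormalAt ev E)
    (hΘ : ∀ X, K.Hor X → ev (K.Θ E K.T X) = 0)
    (hDΘ : ∀ X Y, K.Hor X → ev (K.D Y (K.Θ E K.T X)) = 0) {X Y : L} (hX : K.Hor X)
    (hY : K.Hor Y) :
    ev (K.D K.T (K.Θ E X Y) - K.Θ E (K.br K.T X) Y - K.Θ E X (K.br K.T Y)) =
      -4 * ev (K.N ^ 2 * K.β ^ 3 * K.g (K.f X) Y) := by
  have h := K.ev_d_Θ hE K.T X Y
  have h1 := hΘ _ (hX.br hY)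
  have h2 := hDΘ X Y hX
  have h3 := hDΘ Y X hY
  rw [K.Θ_swap (K.br X Y), K.Θ_swap Y K.T, K.Θ_swap (K.br Y K.T), K.br_swap Y K.T,
    K.f_T, map_zero, K.g_R_T (K.hor_f X), K.g_R_T (K.hor_f Y), hX.T, hY.T, K.g_T_T,
    K.f_skew' X, K.g_symm Y] at h
  rw [K.Θ_swap X (-K.br K.T Y), K.Θ_neg_left, K.Θ_swap (K.br K.T Y)] at h
  simp only [map_sub, map_add, map_neg, map_mul, h1, h2, h3, map_zero, map_pow] at h ⊢
  linear_combination h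

/-- The final computation: a horizontally conformal field with prescribed Lie derivative. -/
theorem eq_zero_of_lie_T {V X : L} {κ r : A} (hw : ∀ X, K.Hor X → K.Hor (K.nab X K.T))
    (hT : ∀ Y, K.g (K.nab K.T K.T) Y = 0)
    (hVT : K.g (K.nab K.T V) K.T = κ) (hκ : ∀ X, K.D X κ = 0) (hr : ∀ X, K.D X r = 0)
    (hVX : ∀ X, K.Hor X → K.g (K.nab K.T V) X + K.g (K.nab X V) K.T = 0)
    (H : L → L → A)
    (hH : ∀ X Y, K.Hor X → K.Hor Y →
      K.g (K.nab X V) Y + K.g (K.nab Y V) X = r * K.g X Y - H X Y)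
    (hlie : ∀ X Y, K.Hor X → K.Hor Y → K.D K.T (H X Y) - H (K.br K.T X) Y - H X (K.br K.T Y) =
      -4 * K.N ^ 2 * K.β ^ 3 * K.g (K.f X) (K.f Y))
    (hX : K.Hor X) : K.N * K.β ^ 2 * κ * K.g X X = 0 := by
  let S : L → L → L → A := LeviCivitaAlgebra.lieG (K := K.toLeviCivitaAlgebra)
  have hS (V X Y : L) : S V X Y = K.g (K.nab X V) Y + K.g (K.nab Y V) X := rfl
  have hS_symm (V X Y : L) : S V X Y = S V Y X := add_comm _ _
  have hS_eq (V X Y : L) : S V X Y = K.D V (K.g X Y) - K.g (K.br V X) Y - K.g X (K.br V Y) :=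
    K.lieG_eq V X Y
  have hST {Y : L} (hY : K.Hor Y) (X : L) : S K.T X Y = 2 * (K.N * K.β) * K.g X Y :=
    lieG_T hw hY X
  have hD (X : L) : K.D X (2 * (K.N * K.β)) = 0 := by
    rw [← map_ofNat (algebraMap ℝ A) 2]; simp
  have hbr (V : L) {X Y : L} (hX : K.Hor X) (hY : K.Hor Y) : S (K.br K.T V) X Y =
      (K.D K.T (S V X Y) - S V (K.br K.T X) Y - S V X (K.br K.T Y)) -
        2 * (K.N * K.β) * S V X Y := by
    have h := K.lieG_br K.T V X Y
    have e1 := hST hY X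
    have e2 := hST hY (K.br V X)
    have e3 := hST hX (K.br V Y)
    rw [hS_symm] at e3
    simp only [S] at e1 e2 e3 ⊢
    rw [h, e1, e2, e3, K.lieG_eq V X Y, Derivation.leibniz, hD, K.g_symm X (K.br V Y)]
    simp only [smul_eq_mul]
    ring
  have hW {X Y : L} (hX : K.Hor X) (hY : K.Hor Y) : S (K.br K.T V) X Y =
      4 * K.N ^ 2 * K.β ^ 3 * K.g (K.f X) (K.f Y) + 2 * (K.N * K.β) * H X Y := by
    rw [hbr V hX hY]
    have e := hST hY X
    rw [hS_eq] at e
    simp only [hS, hH _ _ hX hY, hH _ _ (hX.br_T hw) hY, hH _ _ hX (hY.br_T hw), map_sub,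
      Derivation.leibniz, hr, smul_eq_mul]
    linear_combination r * e - hlie X Y hX hY
  have hc (X : L) : K.D X (4 * K.N ^ 2 * K.β ^ 3) = 0 := by
    rw [← map_ofNat (algebraMap ℝ A) 4, N, β, ← map_pow, ← map_pow, ← map_mul, ← map_mul,
      Derivation.map_algebraMap]
  have hW2 {X Y : L} (hX : K.Hor X) (hY : K.Hor Y) : S (K.br K.T (K.br K.T V)) X Y =
      -(2 * (K.N * K.β) * S (K.br K.T V) X Y) := by
    rw [hbr _ hX hY]
    have e := hST (K.hor_f Y) (K.f X)
    rw [hS_eq, br_T_f hw hX, br_T_f hw hY] at e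
    rw [hW (hX.br_T hw) hY, hW hX (hY.br_T hw), hW hX hY, map_add,
      (K.D K.T).leibniz (4 * K.N ^ 2 * K.β ^ 3), (K.D K.T).leibniz (2 * (K.N * K.β)), hc, hD]
    simp only [smul_eq_mul]
    linear_combination 4 * K.N ^ 2 * K.β ^ 3 * e + 2 * (K.N * K.β) * hlie X Y hX hY
  have hu : K.D K.T (K.g V K.T) = κ := by
    rw [K.D_g, K.g_symm V, hT, hVT, add_zero]
  have hgW {X : L} (hX : K.Hor X) : K.g (K.br K.T V) X = -K.D X (K.g V K.T) := by
    rw [K.br_def, map_sub, LinearMap.sub_apply, K.g_nab_T hX, K.D_g, nab_T_of_hor hw hX, map_smul,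
      smul_eq_mul]
    linear_combination hVX X hX
  have hgW2 {X : L} (hX : K.Hor X) : K.g (K.br K.T (K.br K.T V)) X =
      -(2 * (K.N * K.β) * K.g (K.br K.T V) X) := by
    have e := hST hX (K.br K.T V)
    rw [hS_eq] at e
    have e2 := hgW (hX.br_T hw)
    rw [K.D_br, hu, hκ] at e2
    rw [hgW hX, map_neg] at e
    rw [hgW hX]
    linear_combination -e - e2
  have hWT : K.g (K.br K.T V) K.T = κ := by
    rw [K.br_def, map_sub, LinearMap.sub_apply, K.g_nab_T_T, hVT, sub_zero]
  have hW2T : K.g (K.br K.T (K.br K.T V)) K.T = 0 := by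
    have e := K.D_g K.T (K.br K.T V) K.T
    rw [hWT, hκ, K.g_symm (K.br K.T V), hT] at e
    rw [K.br_def, map_sub, LinearMap.sub_apply, K.g_nab_T_T]
    linear_combination -e
  set W := K.br K.T V
  have hZ (Y : L) (hY : K.Hor Y) : K.g (K.br K.T W + (2 * (K.N * K.β)) • W) Y = 0 := by
    simp [hgW2 hY]
  have e1 := K.g_nab_hor hX X _ hZ
  have e2 := K.D_g X (K.br K.T W + (2 * (K.N * K.β)) • W) X
  have e3 := hW2 hX hX
  rw [hZ X hX, e1, map_zero] at e2
  rw [hS, hS] at e3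
  simp only [map_add, K.nab_smul, hD, LinearMap.add_apply, map_smul, LinearMap.smul_apply, hWT,
    hW2T, zero_smul, zero_add, smul_eq_mul] at e2
  apply eq_of_two_mul_eq
  apply eq_of_two_mul_eq
  linear_combination 2 * e2 + e3

end KenmotsuAlgebra

namespace WeakKenmotsu

noncomputable section

set_option linter.unusedSectionVars false

open Filter Topology

variable {E : Type*} [NormedAddCommGroup E] [NormedSpace ℝ E] [FiniteDimensional ℝ E]
  {H : Type*} [TopologicalSpace H] {I : ModelWithCorners ℝ E H}
  {M : Type*} [TopologicalSpace M] [ChartedSpace H M] [IsManifold I ∞ M]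
  [RiemannianBundle (fun x : M ↦ TangentSpace I x)]
  [IsContMDiffRiemannianBundle I ∞ E (fun x : M ↦ TangentSpace I x)]

/-- The directional derivative of a smooth function along a smooth field is smooth. -/
theorem contMDiff_mvfderiv {φ : M → ℝ} {X : Π x : M, TangentSpace I x}
    (hφ : CMDiff ∞ φ) (hX : CMDiff ∞ (T% X)) : CMDiff ∞ (fun y ↦ d% φ y (X y)) := by
  have h1 := hφ.contMDiff_tangentMap (m := ∞) (by norm_num)
  exact (contMDiff_snd_tangentBundle_modelSpace ℝ 𝓘(ℝ, ℝ)).comp (h1.comp hX)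

theorem contMDiff_mlieBracket {X Y : Π x : M, TangentSpace I x}
    (hX : CMDiff ∞ (T% X)) (hY : CMDiff ∞ (T% Y)) :
    CMDiff ∞ (T% (VectorField.mlieBracket I X Y)) := by
  have : CompleteSpace E := FiniteDimensional.complete ℝ E
  have : IsManifold I (((⊤ : ℕ∞) : ℕ∞ω) + 1) M := by simpa using ‹IsManifold I ∞ M›
  have : IsManifold I (minSmoothness ℝ 2) M := IsManifold.of_le (n := ∞) (by simpa using ENat.LEInfty.out)
  exact ContDiff.mlieBracket_vectorField (m := ⊤) (n := ⊤) hX hY (by simp)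

theorem contMDiff_koszul {X Y Z : Π x : M, TangentSpace I x} (hX : CMDiff ∞ (T% X))
    (hY : CMDiff ∞ (T% Y)) (hZ : CMDiff ∞ (T% Z)) : CMDiff ∞ (koszul I Y X Z) := by
  have hi {X Y : Π x : M, TangentSpace I x} (hX : CMDiff ∞ (T% X)) (hY : CMDiff ∞ (T% Y)) :
      CMDiff ∞ (fun y ↦ (inner ℝ (X y) (Y y) : ℝ)) := ContMDiff.inner_bundle hX hY
  unfold koszul
  refine contMDiff_const.mul ?_
  exact (((((contMDiff_mvfderiv (hi hY hZ) hX).add (contMDiff_mvfderiv (hi hX hZ) hY)).sub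
    (contMDiff_mvfderiv (hi hX hY) hZ)).add (hi (contMDiff_mlieBracket hX hY) hZ)).sub
    (hi (contMDiff_mlieBracket hX hZ) hY)).sub (hi (contMDiff_mlieBracket hY hZ) hX)

/-- Smooth vector fields. -/
abbrev VF (I : ModelWithCorners ℝ E H) (M : Type*) [TopologicalSpace M] [ChartedSpace H M]
    [IsManifold I ∞ M] := Cₛ^∞⟮I; E, (TangentSpace I : M → Type _)⟯

/-- Smooth functions. -/
abbrev SF (I : ModelWithCorners ℝ E H) (M : Type*) [TopologicalSpace M] [ChartedSpace H M] :=
  C^∞⟮I, M; 𝓘(ℝ, ℝ), ℝ⟯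

instance : SMul (SF I M) (VF I M) :=
  ⟨fun a X ↦ ⟨(a : M → ℝ) • (X : Π x, TangentSpace I x), a.contMDiff.smul_section X.contMDiff⟩⟩

theorem sf_smul_apply (a : SF I M) (X : VF I M) (x : M) : (a • X) x = a x • X x := rfl

instance : Module (SF I M) (VF I M) where
  one_smul X := by ext x; simp [sf_smul_apply]
  mul_smul a b X := by ext x; simp [sf_smul_apply, mul_smul]
  smul_zero a := by ext x; simp [sf_smul_apply]
  smul_add a X Y := by ext x; simp [sf_smul_apply]
  add_smul a b X := by ext x; simp [sf_smul_apply, add_smul]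
  zero_smul X := by ext x; simp [sf_smul_apply]

section Extension

variable [T2Space M]

theorem exists_section_eventuallyEq {σ : Π x : M, TangentSpace I x} {u : Set M} {x : M}
    (hu : IsOpen u) (hx : x ∈ u) (hσ : CMDiff[u] ∞ (T% σ)) :
    ∃ Y : VF I M, ∀ᶠ y in 𝓝 x, Y y = σ y := by
  obtain ⟨χ, -, hχ⟩ := (SmoothBumpFunction.nhds_basis_tsupport (I := I) x).mem_iff.1
    (hu.mem_nhds hx)
  refine ⟨⟨(χ : M → ℝ) • σ, ContMDiffOn.smul_section_of_tsupport χ.contMDiff.contMDiffOn hu hχ hσ⟩, ?_⟩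
  filter_upwards [χ.eventuallyEq_one] with y hy
  simp [hy]

theorem exists_bump {u : Set M} {x : M} (hu : u ∈ 𝓝 x) :
    ∃ χ : SF I M, χ x = 1 ∧ ∀ y ∉ u, χ y = 0 := by
  obtain ⟨χ, -, hχ⟩ := (SmoothBumpFunction.nhds_basis_tsupport (I := I) x).mem_iff.1 hu
  exact ⟨⟨χ, χ.contMDiff⟩, χ.eq_one, fun y hy ↦ image_eq_zero_of_notMem_tsupport fun h ↦ hy (hχ h)⟩

/-- A smooth field with a prescribed value, which agrees near the point with the extension of the
vector that is constant in the trivialization. -/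
theorem exists_extend (x : M) (u : TangentSpace I x) :
    ∃ Y : VF I M, Y x = u ∧ ∀ᶠ y in 𝓝 x, Y y = FiberBundle.extend E u y := by
  obtain ⟨s, hs, h⟩ := FiberBundle.exists_contMDiffOn_extend (k := ∞) I E u
  obtain ⟨t, hts, ht, hxt⟩ := mem_nhds_iff.1 hs
  obtain ⟨Y, hY⟩ := exists_section_eventuallyEq ht hxt (h.mono hts)
  exact ⟨Y, by simp [hY.self_of_nhds], hY⟩

theorem exists_orthonormal_frame (x : M) :
    ∃ F : Fin (Module.finrank ℝ E) → VF I M, ∀ᶠ y in 𝓝 x, Orthonormal ℝ (fun i ↦ F i y) := by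
  let b := Module.finBasis ℝ E
  let e := trivializationAt E (TangentSpace I : M → Type _) x
  let s : Fin (Module.finrank ℝ E) → Π y : M, TangentSpace I y := e.localFrame b
  have hs : IsLocalFrameOn I E ∞ s e.baseSet := e.isLocalFrameOn_localFrame_baseSet I ∞ b
  have hxe : x ∈ e.baseSet := FiberBundle.mem_baseSet_trivializationAt' x
  let G (i : Fin (Module.finrank ℝ E)) (y : M) : TangentSpace I y :=
    InnerProductSpace.gramSchmidt ℝ (fun j ↦ s j y) i
  have hne {y : M} (hy : y ∈ e.baseSet) (i) : G i y ≠ 0 :=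
    InnerProductSpace.gramSchmidt_ne_zero i (hs.linearIndependent hy)
  have hG (i) : CMDiff[e.baseSet] ∞ (T% (G i)) := by
    induction i using WellFoundedLT.induction with
    | ind i ih =>
      have hGi : G i = fun y ↦ s i y - ∑ j ∈ Finset.Iio i,
          (inner ℝ (G j y) (s i y) / inner ℝ (G j y) (G j y)) • G j y := by
        funext y
        simp only [G]
        rw [InnerProductSpace.gramSchmidt_def]
        simp [Submodule.starProjection_singleton]
      rw [hGi]
      refine (hs.contMDiffOn i).sub_section (ContMDiffOn.sum_section fun j hj ↦ ?_)
      have hj := ih j (Finset.mem_Iio.1 hj)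
      refine ContMDiffOn.smul_section (ContMDiffOn.div₀ ?_ ?_ ?_) hj
      · exact ContMDiffOn.inner_bundle hj (hs.contMDiffOn i)
      · exact ContMDiffOn.inner_bundle hj hj
      · exact fun y hy ↦ by simpa using hne hy j
  have hN (i) : CMDiff[e.baseSet] ∞ (T% (fun y ↦ ‖G i y‖⁻¹ • G i y)) := by
    refine ContMDiffOn.smul_section ?_ (hG i)
    have h1 : CMDiff[e.baseSet] ∞ (fun y ↦ (inner ℝ (G i y) (G i y) : ℝ)) :=
      ContMDiffOn.inner_bundle (hG i) (hG i)
    have h2 (y) : ‖G i y‖ = √(inner ℝ (G i y) (G i y)) := by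
      rw [real_inner_self_eq_norm_sq, Real.sqrt_sq (norm_nonneg _)]
    simp only [h2]
    refine ContMDiffOn.inv₀ (fun y hy ↦ ?_) fun y hy ↦ ?_
    · refine ContMDiffAt.comp_contMDiffWithinAt y (ContDiffAt.contMDiffAt ?_) (h1 y hy)
      exact Real.contDiffAt_sqrt (by simpa using hne hy i)
    · rw [← h2]; simpa using hne hy i
  choose F hF using fun i ↦ exists_section_eventuallyEq e.open_baseSet hxe (hN i)
  refine ⟨F, ?_⟩
  filter_upwards [eventually_all.2 hF, e.open_baseSet.mem_nhds hxe] with y hy hye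
  simp only [hy]
  exact InnerProductSpace.gramSchmidtNormed_orthonormal (hs.linearIndependent hye)

end Extension

end

end WeakKenmotsu

namespace WeakKenmotsu

noncomputable section

set_option linter.unusedSectionVars false

open Filter Topology

variable {E : Type*} [NormedAddCommGroup E] [NormedSpace ℝ E] [FiniteDimensional ℝ E]
  {H : Type*} [TopologicalSpace H] {I : ModelWithCorners ℝ E H}
  {M : Type*} [TopologicalSpace M] [ChartedSpace H M] [IsManifold I ∞ M]
  [RiemannianBundle (fun x : M ↦ TangentSpace I x)]
  [IsContMDiffRiemannianBundle I ∞ E (fun x : M ↦ TangentSpace I x)]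

theorem exists_orthonormalBasis {y : M} {v : Fin (Module.finrank ℝ E) → TangentSpace I y}
    (hv : Orthonormal ℝ v) :
    ∃ b : OrthonormalBasis (Fin (Module.finrank ℝ E)) ℝ (TangentSpace I y), ⇑b = v := by
  have := finiteDimensional_tangentSpace I y
  have hc : Fintype.card (Fin (Module.finrank ℝ E)) = Module.finrank ℝ (TangentSpace I y) := by
    rw [Fintype.card_fin]; rfl
  rcases Nat.eq_zero_or_pos (Module.finrank ℝ E) with h0 | h0
  · have : IsEmpty (Fin (Module.finrank ℝ E)) := by rw [h0]; infer_instance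
    have hs : Subsingleton (TangentSpace I y) :=
      Module.finrank_zero_iff.1 (show Module.finrank ℝ (TangentSpace I y) = 0 from h0)
    exact ⟨OrthonormalBasis.mk hv fun z _ ↦ by simp [Subsingleton.elim z 0], by simp⟩
  · have : Nonempty (Fin (Module.finrank ℝ E)) := ⟨⟨0, h0⟩⟩
    have hb : ⇑(basisOfOrthonormalOfCardEqFinrank hv hc) = v := by simp
    exact ⟨(basisOfOrthonormalOfCardEqFinrank hv hc).toOrthonormalBasis (by rwa [hb]), by simp⟩

theorem eq_sum_inner_smul {y : M} {v : Fin (Module.finrank ℝ E) → TangentSpace I y}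
    (hv : Orthonormal ℝ v) (z : TangentSpace I y) : z = ∑ i, (inner ℝ (v i) z : ℝ) • v i := by
  obtain ⟨b, rfl⟩ := exists_orthonormalBasis hv
  exact (b.sum_repr' z).symm

theorem VF.mdiffAt (X : VF I M) (x : M) : MDiffAt (T% (fun y ↦ X y)) x := X.mdifferentiableAt

theorem SF.mdiffAt (a : SF I M) (x : M) : MDiffAt (fun y ↦ a y) x :=
  a.contMDiff.mdifferentiable (by simp) x

variable [T2Space M]

theorem contMDiff_leviCivita (X Y : VF I M) :
    CMDiff ∞ (T% (fun y ↦ leviCivita I M (fun z ↦ Y z) y (X y))) := by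
  intro x
  obtain ⟨F, hF⟩ := exists_orthonormal_frame (I := I) x
  have h : CMDiff ∞ (T% (fun y ↦ ∑ i, koszul I Y X (F i) y • F i y)) :=
    ContMDiff.sum_section fun i _ ↦
      (contMDiff_koszul X.contMDiff Y.contMDiff (F i).contMDiff).smul_section (F i).contMDiff
  refine (h x).congr_of_eventuallyEq ?_
  filter_upwards [hF] with y hy
  rw [TotalSpace.mk_inj, eq_sum_inner_smul hy (leviCivita I M (fun z ↦ Y z) y (X y))]
  refine Finset.sum_congr rfl fun i _ ↦ ?_
  rw [real_inner_comm, inner_leviCivita (X.mdiffAt y) (Y.mdiffAt y) ((F i).mdiffAt y)]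

/-- The covariant derivative of smooth fields. -/
def nab (X Y : VF I M) : VF I M :=
  ⟨fun y ↦ leviCivita I M (fun z ↦ Y z) y (X y), contMDiff_leviCivita X Y⟩

theorem nab_apply (X Y : VF I M) (y : M) :
    nab X Y y = leviCivita I M (fun z ↦ Y z) y (X y) := rfl

omit [T2Space M] in
theorem contMDiff_inner (X Y : VF I M) : CMDiff ∞ (fun y ↦ (inner ℝ (X y) (Y y) : ℝ)) :=
  ContMDiff.inner_bundle X.contMDiff Y.contMDiff

/-- The inner product of smooth fields. -/
def metric : VF I M →ₗ[SF I M] VF I M →ₗ[SF I M] SF I M :=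
  LinearMap.mk₂ _ (fun X Y ↦ ⟨fun y ↦ inner ℝ (X y) (Y y), contMDiff_inner X Y⟩)
    (fun X X' Y ↦ ContMDiffMap.ext fun y ↦ inner_add_left (𝕜 := ℝ) (X y) (X' y) (Y y))
    (fun a X Y ↦ ContMDiffMap.ext fun y ↦ real_inner_smul_left (X y) (Y y) (a y))
    (fun X Y Y' ↦ ContMDiffMap.ext fun y ↦ inner_add_right (𝕜 := ℝ) (X y) (Y y) (Y' y))
    (fun a X Y ↦ ContMDiffMap.ext fun y ↦ real_inner_smul_right (X y) (Y y) (a y))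

omit [T2Space M] in
theorem metric_apply (X Y : VF I M) (y : M) : metric X Y y = inner ℝ (X y) (Y y) := rfl

omit [T2Space M] in
theorem SF.mvfderiv_add (a b : SF I M) (y : M) (u : TangentSpace I y) :
    d% (fun z ↦ (a + b) z) y u = d% (fun z ↦ a z) y u + d% (fun z ↦ b z) y u :=
  DFunLike.congr_fun (mvfderiv_fun_add (a.mdiffAt y) (b.mdiffAt y)) u

omit [T2Space M] in
theorem SF.mvfderiv_mul (a b : SF I M) (y : M) (u : TangentSpace I y) :
    d% (fun z ↦ (a * b) z) y u = a y * d% (fun z ↦ b z) y u + b y * d% (fun z ↦ a z) y u := by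
  refine (DFunLike.congr_fun (mvfderiv_fun_mul (a.mdiffAt y) (b.mdiffAt y)) u).trans ?_
  simp

omit [T2Space M] in
theorem SF.mvfderiv_smul (r : ℝ) (a : SF I M) (y : M) (u : TangentSpace I y) :
    d% (fun z ↦ (r • a) z) y u = r * d% (fun z ↦ a z) y u := by
  refine (DFunLike.congr_fun (mvfderiv_fun_mul (f := fun _ ↦ r) mdifferentiableAt_const
    (a.mdiffAt y)) u).trans ?_
  rw [mvfderiv_const]
  simp

/-- The derivation of the algebra of smooth functions that is given by a smooth field. -/
def dirDeriv : VF I M →ₗ[SF I M] Derivation ℝ (SF I M) (SF I M) where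
  toFun X := Derivation.mk'
    { toFun := fun a ↦
        ⟨fun y ↦ d% (fun z ↦ a z) y (X y), contMDiff_mvfderiv a.contMDiff X.contMDiff⟩
      map_add' := fun a b ↦ ContMDiffMap.ext fun y ↦ SF.mvfderiv_add a b y (X y)
      map_smul' := fun r a ↦ ContMDiffMap.ext fun y ↦ SF.mvfderiv_smul r a y (X y) }
    (fun a b ↦ ContMDiffMap.ext fun y ↦ SF.mvfderiv_mul a b y (X y))
  map_add' X X' := Derivation.ext fun a ↦ ContMDiffMap.ext fun y ↦
    map_add (d% (fun z ↦ a z) y) (X y) (X' y)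
  map_smul' b X := Derivation.ext fun a ↦ ContMDiffMap.ext fun y ↦
    map_smul (d% (fun z ↦ a z) y) (b y) (X y)

omit [T2Space M] in
theorem dirDeriv_apply (X : VF I M) (a : SF I M) (y : M) :
    dirDeriv X a y = d% (fun z ↦ a z) y (X y) := rfl

theorem nab_sub_nab (X Y : VF I M) (y : M) :
    (nab X Y - nab Y X) y = VectorField.mlieBracket I (fun z ↦ X z) (fun z ↦ Y z) y :=
  leviCivita_sub_swap (X.mdiffAt y) (Y.mdiffAt y)

theorem nab_sub_nab_coe (X Y : VF I M) :
    (fun y ↦ (nab X Y - nab Y X) y) = VectorField.mlieBracket I (fun z ↦ X z) (fun z ↦ Y z) :=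
  funext fun y ↦ nab_sub_nab X Y y

theorem jacobi_VF (X Y Z : VF I M) : nab X (nab Y Z - nab Z Y) - nab (nab Y Z - nab Z Y) X =
    (nab (nab X Y - nab Y X) Z - nab Z (nab X Y - nab Y X)) +
      (nab Y (nab X Z - nab Z X) - nab (nab X Z - nab Z X) Y) := by
  have : CompleteSpace E := FiniteDimensional.complete ℝ E
  have : IsManifold I (minSmoothness ℝ 3) M :=
    IsManifold.of_le (n := ∞) (by simpa using ENat.LEInfty.out)
  have hs (X : VF I M) (y : M) : CMDiffAt (minSmoothness ℝ 2) (T% (fun y ↦ X y)) y :=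
    (X.contMDiff y).of_le (by simpa using ENat.LEInfty.out)
  ext y
  have h := VectorField.leibniz_identity_mlieBracket_apply (hs X y) (hs Y y) (hs Z y)
  rw [ContMDiffSection.coe_add, Pi.add_apply]
  simpa only [nab_sub_nab, nab_sub_nab_coe] using h

theorem D_bracket_VF (X Y : VF I M) (a : SF I M) :
    dirDeriv (nab X Y - nab Y X) a = dirDeriv X (dirDeriv Y a) - dirDeriv Y (dirDeriv X a) := by
  have hbr (X Y : VF I M) (b : SF I M) : nab X (b • Y) - nab (b • Y) X =
      dirDeriv X b • Y + b • (nab X Y - nab Y X) := by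
    have : CompleteSpace E := FiniteDimensional.complete ℝ E
    ext y
    rw [nab_sub_nab]
    refine (VectorField.mlieBracket_smul_right (b.mdiffAt y) (Y.mdiffAt y)).trans ?_
    rw [← nab_sub_nab]
    rfl
  have hZ (Z : VF I M) : (dirDeriv (nab X Y - nab Y X) a -
      (dirDeriv X (dirDeriv Y a) - dirDeriv Y (dirDeriv X a))) • Z = 0 := by
    have h := jacobi_VF X Y (a • Z)
    have hadd (X Y Z : VF I M) : nab X (Y + Z) - nab (Y + Z) X =
        (nab X Y - nab Y X) + (nab X Z - nab Z X) := by
      have : CompleteSpace E := FiniteDimensional.complete ℝ E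
      ext y
      rw [nab_sub_nab]
      refine (VectorField.mlieBracket_add_right (Y.mdiffAt y) (Z.mdiffAt y)).trans ?_
      rw [← nab_sub_nab, ← nab_sub_nab]
      rfl
    simp only [hbr, hadd, jacobi_VF X Y Z, smul_add] at h
    rw [← sub_eq_zero] at h
    rw [← neg_eq_zero, ← h]
    simp only [sub_smul]
    abel
  ext y
  by_cases hu : ∃ u : TangentSpace I y, u ≠ 0
  · obtain ⟨u, hu⟩ := hu
    obtain ⟨Z, hZu, -⟩ := exists_extend y u
    have h := DFunLike.congr_fun (hZ Z) y
    rw [sf_smul_apply, hZu] at h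
    exact sub_eq_zero.1 ((smul_eq_zero.1 h).resolve_right hu)
  · push Not at hu
    have h0 (X : VF I M) (a : SF I M) : dirDeriv X a y = 0 := by
      rw [dirDeriv_apply, hu (X y), map_zero]
    exact (h0 _ _).trans ((congrArg₂ (· - ·) (h0 X (dirDeriv Y a)) (h0 Y (dirDeriv X a))).trans
      (sub_zero 0)).symm

/-- The Levi-Civita algebra of a Riemannian manifold. -/
def lcAlgebra (I : ModelWithCorners ℝ E H) (M : Type*) [TopologicalSpace M] [ChartedSpace H M]
    [IsManifold I ∞ M] [RiemannianBundle (fun x : M ↦ TangentSpace I x)]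
    [IsContMDiffRiemannianBundle I ∞ E (fun x : M ↦ TangentSpace I x)] [T2Space M] :
    LeviCivitaAlgebra (SF I M) (VF I M) where
  D := dirDeriv
  nab :=
    { toFun := fun X ↦
        { toFun := nab X
          map_zero' := by
            ext y
            rw [nab_apply]
            exact DFunLike.congr_fun (congrFun (leviCivita I M).zero y) (X y)
          map_add' := fun Y Y' ↦ by
            ext y
            exact DFunLike.congr_fun ((leviCivita I M).isCovariantDerivativeOnUniv.add
              (Y.mdiffAt y) (Y'.mdiffAt y)) (X y) }
      map_add' := fun X X' ↦ by
        ext Y y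
        exact map_add (leviCivita I M (fun z ↦ Y z) y) (X y) (X' y)
      map_smul' := fun a X ↦ by
        ext Y y
        exact map_smul (leviCivita I M (fun z ↦ Y z) y) (a y) (X y) }
  g := metric
  g_symm X Y := ContMDiffMap.ext fun y ↦ real_inner_comm (Y y) (X y)
  nab_smul X a Y := by
    ext y
    refine (DFunLike.congr_fun ((leviCivita I M).isCovariantDerivativeOnUniv.leibniz
      (Y.mdiffAt y) (a.mdiffAt y)) (X y)).trans ?_
    exact add_comm _ _
  D_g X Y Z := ContMDiffMap.ext fun y ↦
    mvfderiv_inner_eq_leviCivita (X.mdiffAt y) (Y.mdiffAt y) (Z.mdiffAt y)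
  D_bracket := D_bracket_VF
  jacobi := jacobi_VF

end

end WeakKenmotsu

namespace WeakKenmotsu

noncomputable section

set_option linter.unusedSectionVars false

open Filter Topology

variable {E : Type*} [NormedAddCommGroup E] [NormedSpace ℝ E] [FiniteDimensional ℝ E]
  {H : Type*} [TopologicalSpace H] {I : ModelWithCorners ℝ E H}
  {M : Type*} [TopologicalSpace M] [ChartedSpace H M] [IsManifold I ∞ M]
  [RiemannianBundle (fun x : M ↦ TangentSpace I x)]
  [IsContMDiffRiemannianBundle I ∞ E (fun x : M ↦ TangentSpace I x)] [T2Space M]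

theorem VF.sum_apply {κ : Type*} (s : Finset κ) (F : κ → VF I M) (x : M) :
    (∑ i ∈ s, F i) x = ∑ i ∈ s, F i x := by
  classical
  induction s using Finset.induction_on with
  | empty => rfl
  | insert a s ha ih =>
    rw [Finset.sum_insert ha, Finset.sum_insert ha, ← ih]
    rfl

/-- A smooth field that vanishes at a point is a combination of fields with coefficients that
vanish at this point. -/
theorem exists_eq_sum_smul_of_eq_zero {Z : VF I M} {x : M} (hZ : Z x = 0) :
    ∃ (a₀ : SF I M) (Y₀ : VF I M) (a : Fin (Module.finrank ℝ E) → SF I M)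
      (Y : Fin (Module.finrank ℝ E) → VF I M),
      a₀ x = 0 ∧ (∀ i, a i x = 0) ∧ Z = a₀ • Y₀ + ∑ i, a i • Y i := by
  obtain ⟨F, hF⟩ := exists_orthonormal_frame (I := I) x
  obtain ⟨χ, hχ1, hχ0⟩ := exists_bump (I := I) hF
  refine ⟨1 - χ, Z - ∑ i, metric Z (F i) • F i, fun i ↦ metric Z (F i), F, ?_, fun i ↦ ?_, ?_⟩
  · exact (congrArg (fun t ↦ 1 - t) hχ1).trans (sub_self 1)
  · rw [metric_apply, hZ, inner_zero_left]
  · rw [sub_smul, one_smul, eq_comm, sub_add_eq_add_sub, sub_add_cancel, sub_eq_self]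
    ext y
    rw [sf_smul_apply]
    by_cases hy : Orthonormal ℝ (fun i ↦ F i y)
    · have h : (Z - ∑ i, metric Z (F i) • F i) y = 0 := by
        rw [ContMDiffSection.coe_sub, Pi.sub_apply, VF.sum_apply, sub_eq_zero]
        nth_rewrite 1 [eq_sum_inner_smul hy (Z y)]
        refine Finset.sum_congr rfl fun i _ ↦ ?_
        rw [sf_smul_apply, metric_apply, real_inner_comm]
      rw [h, smul_zero]; rfl
    · rw [hχ0 y hy, zero_smul]; rfl

theorem linearMap_apply_eq_zero (φ : VF I M →ₗ[SF I M] SF I M) {Z : VF I M} {x : M}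
    (hZ : Z x = 0) : φ Z x = 0 := by
  obtain ⟨a₀, Y₀, a, Y, h0, ha, rfl⟩ := exists_eq_sum_smul_of_eq_zero hZ
  let ev := ContMDiffMap.evalRingHom (I := I) (n := ∞) (R := ℝ) (I' := 𝓘(ℝ, ℝ)) x
  change ev (φ _) = 0
  have h0' : ev a₀ = 0 := h0
  have ha' (i) : ev (a i) = 0 := ha i
  simp [map_add, map_sum, h0', ha']

theorem linearMap_apply_congr (φ : VF I M →ₗ[SF I M] SF I M) {Z W : VF I M} {x : M}
    (h : Z x = W x) : φ Z x = φ W x := by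
  have h1 := linearMap_apply_eq_zero φ (Z := Z - W) (x := x) (by
    rw [ContMDiffSection.coe_sub, Pi.sub_apply, h, sub_self])
  rw [map_sub] at h1
  exact sub_eq_zero.1 h1

theorem endo_apply_congr (φ : VF I M →ₗ[SF I M] VF I M) {Z W : VF I M} {x : M}
    (h : Z x = W x) : φ Z x = φ W x := by
  refine ext_inner_right ℝ fun u ↦ ?_
  obtain ⟨U, rfl, -⟩ := exists_extend x u
  exact linearMap_apply_congr ((metric.flip U).comp φ) h

/-- Evaluation at a point. -/
def evalAt (I : ModelWithCorners ℝ E H) (x : M) : SF I M →+* ℝ :=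
  ContMDiffMap.evalRingHom (I := I) (n := ∞) (R := ℝ) (I' := 𝓘(ℝ, ℝ)) x

theorem evalAt_apply (x : M) (a : SF I M) : evalAt I x a = a x := rfl

theorem dirDeriv_congr (X : VF I M) {a b : SF I M} {x : M} (h : ∀ᶠ y in 𝓝 x, a y = b y) :
    dirDeriv X a x = dirDeriv X b x := by
  have h' : (fun y ↦ a y) =ᶠ[𝓝 x] (fun y ↦ b y) := h
  have h2 : (mfderiv I 𝓘(ℝ, ℝ) (fun y ↦ a y) x : TangentSpace I x →L[ℝ] ℝ) =
      mfderiv I 𝓘(ℝ, ℝ) (fun y ↦ b y) x := h'.mfderiv_eq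
  exact DFunLike.congr_fun h2 (X x)

theorem orthonormalAt {F : Fin (Module.finrank ℝ E) → VF I M} {x : M}
    (hF : ∀ᶠ y in 𝓝 x, Orthonormal ℝ (fun i ↦ F i y)) :
    (lcAlgebra I M).OrthonormalAt (evalAt I x) F where
  expand φ Z := by
    have h : Z x = (∑ i, metric Z (F i) • F i) x := by
      rw [VF.sum_apply, eq_sum_inner_smul hF.self_of_nhds (Z x)]
      refine Finset.sum_congr rfl fun i _ ↦ ?_
      rw [sf_smul_apply, metric_apply, real_inner_comm]
    rw [evalAt_apply, linearMap_apply_congr φ h, ← evalAt_apply]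
    simp only [map_sum, map_smul, smul_eq_mul, map_mul]
    rfl
  D_g_eq_zero X i j := by
    have h : dirDeriv X (metric (F i) (F j)) x =
        dirDeriv X (algebraMap ℝ (SF I M) (if i = j then 1 else 0)) x := by
      refine dirDeriv_congr X ?_
      filter_upwards [hF] with y hy
      exact orthonormal_iff_ite.1 hy i j
    refine h.trans ?_
    rw [Derivation.map_algebraMap]
    rfl

theorem leviCivita_congr {σ : Π x : M, TangentSpace I x} {Y : VF I M} {x : M}
    (h : ∀ᶠ y in 𝓝 x, σ y = Y y) : leviCivita I M σ x = leviCivita I M (fun y ↦ Y y) x := by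
  have hY := Y.mdiffAt x
  refine (leviCivita I M).isCovariantDerivativeOnUniv.congr_of_eventuallyEq ?_ hY univ_mem h
  refine hY.congr_of_eventuallyEq ?_
  filter_upwards [h] with y hy
  rw [hy]

theorem R_eq_curvature (X Y Z : VF I M) (x : M) :
    (lcAlgebra I M).R X Y Z x = curvature (fun y ↦ X y) (fun y ↦ Y y) (fun y ↦ Z y) x := by
  rw [curvature, ← nab_sub_nab X Y]
  rfl

theorem R_congr {X X' Y Y' Z Z' : VF I M} {x : M} (hX : X x = X' x) (hY : Y x = Y' x)
    (hZ : Z x = Z' x) : (lcAlgebra I M).R X Y Z x = (lcAlgebra I M).R X' Y' Z' x := by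
  have hl {X X' : VF I M} (hX : X x = X' x) (Y Z : VF I M) :
      (lcAlgebra I M).R X Y Z x = (lcAlgebra I M).R X' Y Z x :=
    endo_apply_congr ((lcAlgebra I M).RLeft Y Z) hX
  rw [endo_apply_congr ((lcAlgebra I M).R X Y) hZ, hl hX, (lcAlgebra I M).R_swap,
    (lcAlgebra I M).R_swap X']
  exact congrArg Neg.neg (hl hY X' Z')

/-- The curvature of tangent vectors is computed by any smooth fields with the given values. -/
theorem curvatureAt_eq (X Y Z : VF I M) (x : M) :
    curvatureAt x (X x) (Y x) (Z x) = (lcAlgebra I M).R X Y Z x := by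
  obtain ⟨X', hX, hX'⟩ := exists_extend x (X x)
  obtain ⟨Y', hY, hY'⟩ := exists_extend x (Y x)
  obtain ⟨Z', hZ, hZ'⟩ := exists_extend x (Z x)
  rw [← R_congr hX hY hZ, R_eq_curvature]
  have hZ'' : ∀ᶠ y in 𝓝 x, leviCivita I M (FiberBundle.extend E (Z x)) y =
      leviCivita I M (fun y ↦ Z' y) y := by
    filter_upwards [eventually_eventually_nhds.2 hZ'] with y hy
    exact leviCivita_congr (hy.mono fun _ h ↦ h.symm)
  have h1 {X' Y' : VF I M} {σ : Π x : M, TangentSpace I x} (hY' : ∀ᶠ y in 𝓝 x, Y' y = σ y) :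
      leviCivita I M (fun y ↦ leviCivita I M (FiberBundle.extend E (Z x)) y (σ y)) x =
        leviCivita I M (fun y ↦ leviCivita I M (fun y ↦ Z' y) y (Y' y)) x := by
    refine leviCivita_congr (Y := nab Y' Z') ?_
    filter_upwards [hZ'', hY'] with y hy1 hy2
    rw [hy1, ← hy2]; rfl
  have hb : VectorField.mlieBracket I (FiberBundle.extend E (X x)) (FiberBundle.extend E (Y x)) x =
      VectorField.mlieBracket I (fun y ↦ X' y) (fun y ↦ Y' y) x :=
    Filter.EventuallyEq.mlieBracket_vectorField_eq (hX'.mono fun _ h ↦ h.symm)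
      (hY'.mono fun _ h ↦ h.symm)
  rw [curvatureAt, curvature, curvature, h1 (X' := X') hX', h1 (X' := X') hY', hb,
    hZ''.self_of_nhds, hX'.self_of_nhds, hY'.self_of_nhds]

end

end WeakKenmotsu

namespace WeakKenmotsu

noncomputable section

set_option linter.unusedSectionVars false

open Filter Topology

variable {E : Type*} [NormedAddCommGroup E] [NormedSpace ℝ E] [FiniteDimensional ℝ E]
  {H : Type*} [TopologicalSpace H] {I : ModelWithCorners ℝ E H}
  {M : Type*} [TopologicalSpace M] [ChartedSpace H M] [IsManifold I ∞ M]
  [RiemannianBundle (fun x : M ↦ TangentSpace I x)]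
  [IsContMDiffRiemannianBundle I ∞ E (fun x : M ↦ TangentSpace I x)] [T2Space M]

namespace WeakMetricFStructure

variable {n s : ℕ} (S : WeakMetricFStructure I M n s)

omit [T2Space M] in
theorem f_ξ_apply (x : M) (j : Fin s) : S.f x (S.ξ j x) = 0 := by
  have h := S.inner_f_f x (S.ξ j x) (S.ξ j x)
  rw [S.Q_ξ, real_inner_self_eq_norm_sq, real_inner_self_eq_norm_sq,
    (S.ξ_orthonormal x).1 j] at h
  simpa [S.η_ξ] using h

omit [T2Space M] in
theorem η_apply (x : M) (j : Fin s) (u : TangentSpace I x) : S.η j x u = inner ℝ u (S.ξ j x) := by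
  have h := S.inner_f_f x u (S.ξ j x)
  rw [S.f_ξ_apply, inner_zero_right, S.Q_ξ] at h
  simp [S.η_ξ] at h
  linarith

omit [T2Space M] in
theorem eq_sum_of_f_eq_zero {x : M} {u : TangentSpace I x} (hu : S.f x u = 0) :
    u = ∑ i, (inner ℝ u (S.ξ i x) : ℝ) • S.ξ i x := by
  have h := S.f_f x u
  rw [hu, map_zero, eq_comm, neg_add_eq_zero] at h
  apply (S.Q_nonsingular x).1
  rw [h, map_sum]
  refine Finset.sum_congr rfl fun i _ ↦ ?_
  rw [map_smul, S.Q_ξ, S.η_apply]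

omit [T2Space M] in
/-- A horizontal vector is in the image of `f ∘ f`. -/
theorem exists_f_f_eq {x : M} {u : TangentSpace I x} (hu : ∀ i, inner ℝ u (S.ξ i x) = (0 : ℝ)) :
    ∃ v, S.f x (S.f x v) = u := by
  obtain ⟨v, hv⟩ := (S.Q_nonsingular x).2 (-u)
  refine ⟨v, ?_⟩
  rw [S.f_f, hv, neg_neg, add_eq_left]
  refine Finset.sum_eq_zero fun i _ ↦ ?_
  rw [S.η_apply, ← S.Q_ξ x i, ← S.Q_selfAdjoint, hv, inner_neg_left, hu, neg_zero, zero_smul]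

/-- The Kenmotsu algebra of a weak `βf`-Kenmotsu manifold. -/
def kenmotsuAlgebra (β : ℝ) (hS : S.IsWeakKenmotsu β) :
    KenmotsuAlgebra (SF I M) (VF I M) (Fin s) where
  toLeviCivitaAlgebra := lcAlgebra I M
  ξ i := ⟨S.ξ i, S.contMDiff_ξ i⟩
  f :=
    { toFun := fun X ↦ ⟨fun y ↦ S.f y (X y), S.contMDiff_f.clm_bundle_apply X.contMDiff⟩
      map_add' := fun X Y ↦ ContMDiffSection.ext fun y ↦ map_add (S.f y) (X y) (Y y)
      map_smul' := fun a X ↦ ContMDiffSection.ext fun y ↦ map_smul (S.f y) (a y) (X y) }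
  b := β
  g_ξ i j := ContMDiffMap.ext fun y ↦ by
    refine (orthonormal_iff_ite.1 (S.ξ_orthonormal y) i j).trans ?_
    split_ifs <;> rfl
  f_skew X Y := ContMDiffMap.ext fun y ↦ S.f_skew y (X y) (Y y)
  f_ξ i := ContMDiffSection.ext fun y ↦ S.f_ξ_apply y i
  eq_of_f_eq_zero X hX := by
    ext y
    have h : S.f y (X y) = 0 := DFunLike.congr_fun hX y
    rw [VF.sum_apply]
    exact S.eq_sum_of_f_eq_zero h
  nab_f X Y := by
    ext y
    refine (hS y (fun z ↦ X z) (fun z ↦ Y z) (X.mdiffAt y) (Y.mdiffAt y)).trans ?_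
    have h1 : S.ηbar y (Y y) = inner ℝ (Y y) (S.ξbar y) := by
      simp [ηbar, ξbar, S.η_apply, inner_sum]
    have h2 : (∑ i, (⟨S.ξ i, S.contMDiff_ξ i⟩ : VF I M)) y = S.ξbar y := VF.sum_apply _ _ y
    rw [h1, ← h2]
    rfl

end WeakMetricFStructure

namespace KenmotsuGeometry

variable {n s : ℕ} {S : WeakMetricFStructure I M n s} {β : ℝ} (hS : S.IsWeakKenmotsu β)

open WeakMetricFStructure

local notation "𝓚" => kenmotsuAlgebra S β hS

theorem f_apply (X : VF I M) (x : M) : (𝓚).f X x = S.f x (X x) := rfl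

theorem ξ_apply (i : Fin s) (x : M) : (𝓚).ξ i x = S.ξ i x := rfl

theorem g_apply (X Y : VF I M) (x : M) : (𝓚).g X Y x = inner ℝ (X x) (Y x) := rfl

theorem T_apply (x : M) : (𝓚).T x = S.ξbar x := VF.sum_apply _ _ x

theorem g_T_apply (X : VF I M) (x : M) : (𝓚).g X (𝓚).T x = S.ηbar x (X x) := by
  rw [g_apply, T_apply]
  simp [ηbar, ξbar, S.η_apply, inner_sum]

theorem lieG_apply (V X Y : VF I M) (x : M) :
    (LeviCivitaAlgebra.lieG (K := lcAlgebra I M) V X Y) x =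
      lieDerivMetric (fun y ↦ V y) (fun y ↦ X y) (fun y ↦ Y y) x := by
  rw [LeviCivitaAlgebra.lieG_eq, lieDerivMetric, ← nab_sub_nab, ← nab_sub_nab]
  rfl

/-- The trace of `f R_{X,Y}` does not depend on the orthonormal frame. -/
theorem Θ_f_apply {F : Fin (Module.finrank ℝ E) → VF I M} {x : M}
    (hF : ∀ᶠ y in 𝓝 x, Orthonormal ℝ (fun i ↦ F i y)) (X Y : VF I M) :
    (𝓚).Θ F X ((𝓚).f Y) x = 2 * starRicci S.f x (X x) (Y x) := by
  have := finiteDimensional_tangentSpace I x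
  have hE := orthonormalAt hF
  let b := stdOrthonormalBasis ℝ (TangentSpace I x)
  choose G hG _ using fun i ↦ exists_extend x (b i)
  let B : VF I M →ₗ[SF I M] VF I M := (𝓚).f.comp ((𝓚).R X ((𝓚).f Y))
  have h1 : starRicci S.f x (X x) (Y x) = (1 / 2) * ∑ i, evalAt I x ((𝓚).g (B (G i)) (G i)) := by
    rw [starRicci]
    congr 1
    refine Finset.sum_congr rfl fun i _ ↦ ?_
    change inner ℝ (S.f x (curvatureAt x (X x) (S.f x (Y x)) (b i))) (b i) = _
    rw [← hG i, ← f_apply hS, curvatureAt_eq]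
    rfl
  have h2 (Z : VF I M) (i) : evalAt I x ((𝓚).g Z (F i)) = inner ℝ (Z x) (F i x) := rfl
  have h3 (i j) : (inner ℝ (F i x) (F j x) : ℝ) = if i = j then 1 else 0 :=
    orthonormal_iff_ite.1 hF.self_of_nhds i j
  have h4 (i) : evalAt I x ((𝓚).g (B (G i)) (G i)) =
      ∑ j, ∑ k, inner ℝ (F j x) (b i) * inner ℝ (b i) (F k x) *
        evalAt I x ((𝓚).g (B (F j)) (F k)) := by
    refine (hE.expand (((𝓚).g.flip (G i)).comp B) (G i)).trans ?_
    refine Finset.sum_congr rfl fun j _ ↦ ?_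
    have h5 := hE.expand ((𝓚).g (B (F j))) (G i)
    refine (congrArg _ h5).trans ?_
    rw [Finset.mul_sum]
    refine Finset.sum_congr rfl fun k _ ↦ ?_
    change inner ℝ (G i x) (F j x) * (inner ℝ (G i x) (F k x) * _) = _
    rw [hG, real_inner_comm, mul_assoc]
  have h6 : ∑ i, evalAt I x ((𝓚).g (B (G i)) (G i)) =
      ∑ j, evalAt I x ((𝓚).g (B (F j)) (F j)) := by
    simp only [h4]
    rw [Finset.sum_comm]
    refine Finset.sum_congr rfl fun j _ ↦ ?_
    rw [Finset.sum_comm]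
    simp only [← Finset.sum_mul, b.sum_inner_mul_inner, h3]
    simp
  rw [h1, h6, ← evalAt_apply, KenmotsuAlgebra.Θ, map_sum]
  have h7 : (2 : ℝ) * (1 / 2 * ∑ j, evalAt I x ((𝓚).g (B (F j)) (F j))) =
    ∑ j, evalAt I x ((𝓚).g (B (F j)) (F j)) := by ring
  rw [h7]
  rfl

theorem Θ_congr_right {F : Fin (Module.finrank ℝ E) → VF I M} {x : M} (X : VF I M)
    {Y Y' : VF I M} (h : Y x = Y' x) : (𝓚).Θ F X Y x = (𝓚).Θ F X Y' x := by
  rw [← evalAt_apply, ← evalAt_apply, KenmotsuAlgebra.Θ, KenmotsuAlgebra.Θ, map_sum, map_sum]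
  refine Finset.sum_congr rfl fun i _ ↦ ?_
  have h1 : (𝓚).R X Y (F i) x = (𝓚).R X Y' (F i) x := R_congr rfl h rfl
  rw [evalAt_apply, evalAt_apply, g_apply, g_apply, f_apply, f_apply, h1]

theorem exists_f_f {Y : VF I M} (hY : (𝓚).Hor Y) (x : M) :
    ∃ X : VF I M, (𝓚).f ((𝓚).f X) x = Y x := by
  obtain ⟨v, hv⟩ := S.exists_f_f_eq (u := Y x) fun i ↦ DFunLike.congr_fun (hY i) x
  obtain ⟨X, rfl, -⟩ := exists_extend x v
  exact ⟨X, hv⟩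

theorem exists_hor (hn : 0 < n) (x : M) : ∃ X : VF I M, (𝓚).Hor X ∧ (𝓚).g X X x ≠ 0 := by
  have hne : ∃ u, S.f x u ≠ 0 := by
    by_contra! h
    have h0 := S.f_rank x
    have h1 : S.f x = 0 := ContinuousLinearMap.ext h
    have h2 : (S.f x).range = ⊥ := by
      rw [h1]; exact LinearMap.range_zero
    rw [h2, finrank_bot] at h0
    omega
  obtain ⟨u, hu⟩ := hne
  obtain ⟨X, rfl, -⟩ := exists_extend x u
  refine ⟨(𝓚).f X, (𝓚).hor_f X, ?_⟩
  rw [g_apply, f_apply]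
  exact inner_self_ne_zero.2 hu

variable {V : VF I M} {l m : ℝ} (h : S.IsStarEtaRicciSoliton (fun y ↦ V y) l m)

include hS h in
theorem soliton_apply {F : Fin (Module.finrank ℝ E) → VF I M} {x : M}
    (hF : ∀ᶠ y in 𝓝 x, Orthonormal ℝ (fun i ↦ F i y)) (X Y : VF I M) :
    LeviCivitaAlgebra.lieG (K := lcAlgebra I M) V X Y x + (𝓚).Θ F X ((𝓚).f Y) x =
      2 * (l * ((𝓚).g X Y x - ∑ i, (𝓚).g X ((𝓚).ξ i) x * (𝓚).g Y ((𝓚).ξ i) x) +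
        (l + m) * ((𝓚).g X (𝓚).T x * (𝓚).g Y (𝓚).T x)) := by
  have h1 := h x (fun y ↦ X y) (fun y ↦ Y y) (X.mdiffAt x) (Y.mdiffAt x)
  simp only [S.η_apply] at h1
  rw [lieG_apply, Θ_f_apply hS hF, g_T_apply, g_T_apply]
  simp only [g_apply, ξ_apply]
  linarith

include hS h in
theorem Θ_symm {F : Fin (Module.finrank ℝ E) → VF I M} {x : M}
    (hF : ∀ᶠ y in 𝓝 x, Orthonormal ℝ (fun i ↦ F i y)) (X Y : VF I M) :
    (𝓚).Θ F X ((𝓚).f Y) x = (𝓚).Θ F Y ((𝓚).f X) x := by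
  have h1 := soliton_apply hS h hF X Y
  have h2 := soliton_apply hS h hF Y X
  have h3 : LeviCivitaAlgebra.lieG (K := lcAlgebra I M) V X Y =
    LeviCivitaAlgebra.lieG (K := lcAlgebra I M) V Y X := add_comm _ _
  rw [(𝓚).g_symm Y X] at h2
  simp only [mul_comm ((𝓚).g Y _ x)] at h2
  rw [h3] at h1
  linarith

theorem Θ_zero_right {F : Fin (Module.finrank ℝ E) → VF I M} (X : VF I M) : (𝓚).Θ F X 0 = 0 := by
  have h := (𝓚).Θ_neg_left (E := F) 0 X
  rw [neg_zero] at h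
  have h2 := (𝓚).Θ_swap (E := F) X 0
  rw [h2, neg_eq_zero]
  apply eq_of_two_mul_eq
  linear_combination h

include hS h in
theorem Θ_vertical {F : Fin (Module.finrank ℝ E) → VF I M} {x : M}
    (hF : ∀ᶠ y in 𝓝 x, Orthonormal ℝ (fun i ↦ F i y)) {U : VF I M} (hU : (𝓚).f U = 0)
    (X : VF I M) : (𝓚).Θ F U ((𝓚).f X) x = 0 := by
  rw [Θ_symm hS h hF, hU, Θ_zero_right]
  rfl

include hS h in
theorem hor_nab_T (hβ : β ≠ 0) (X : VF I M) (hX : (𝓚).Hor X) : (𝓚).Hor ((𝓚).nab X (𝓚).T) := by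
  intro k
  have hα : (𝓚).α k X = 0 := by
    ext x
    obtain ⟨Y, hY⟩ := exists_f_f hS hX x
    obtain ⟨F, hF⟩ := exists_orthonormal_frame (I := I) x
    have h1 := (𝓚).ev_Θ_ξ (orthonormalAt hF) Y k
    rw [evalAt_apply, Θ_vertical hS h hF ((𝓚).f_ξ k), map_mul] at h1
    have h2 : evalAt I x (𝓚).β = β := rfl
    rw [h2] at h1
    rw [← linearMap_apply_congr ((𝓚).α k) hY]
    have h3 : evalAt I x ((𝓚).α k ((𝓚).f ((𝓚).f Y))) = 0 := by
      have := mul_ne_zero two_ne_zero hβ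
      apply (mul_eq_zero.1 _).resolve_left this
      linarith
    exact h3
  rw [KenmotsuAlgebra.α_apply, hX.T, mul_zero, add_zero] at hα
  exact hα

theorem nab_T_T (hn : 0 < n) (hβ : β ≠ 0) (Y : VF I M) : (𝓚).g ((𝓚).nab (𝓚).T (𝓚).T) Y = 0 := by
  refine (𝓚).nab_T_T_of_symm (fun j k ↦ ?_) Y
  ext x
  obtain ⟨X, hX, hX'⟩ := exists_hor hS hn x
  have h1 := congrArg (evalAt I x) ((𝓚).g_nab_ξ_T_symm hX j k)
  rw [map_mul, map_mul, map_sub, map_zero] at h1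
  have h2 := (mul_eq_zero.1 ((mul_eq_zero.1 h1).resolve_right hX')).resolve_left hβ
  exact sub_eq_zero.1 h2

include hS h in
theorem lie_T_ricci (hβ : β ≠ 0) {X Y : VF I M} (hX : (𝓚).Hor X) (hY : (𝓚).Hor Y) :
    let R (X Y : VF I M) : SF I M := algebraMap ℝ _ (2 * l) * (𝓚).g X Y -
      LeviCivitaAlgebra.lieG (K := lcAlgebra I M) V X Y
    (𝓚).D (𝓚).T (R X Y) - R ((𝓚).br (𝓚).T X) Y - R X ((𝓚).br (𝓚).T Y) =
      -4 * (𝓚).N ^ 2 * (𝓚).β ^ 3 * (𝓚).g ((𝓚).f X) ((𝓚).f Y) := by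
  intro R
  ext x
  obtain ⟨F, hF⟩ := exists_orthonormal_frame (I := I) x
  have hw := hor_nab_T hS h hβ
  have hR {y : M} (hF : ∀ᶠ y in 𝓝 y, Orthonormal ℝ (fun i ↦ F i y)) {X Y : VF I M}
      (hX : (𝓚).Hor X) (hY : (𝓚).Hor Y) : R X Y y = (𝓚).Θ F X ((𝓚).f Y) y := by
    have h1 := soliton_apply hS h hF X Y
    rw [hX.T, hY.T] at h1
    simp only [hX _, hY _] at h1
    have h2 : R X Y y = 2 * l * (𝓚).g X Y y -
      LeviCivitaAlgebra.lieG (K := lcAlgebra I M) V X Y y := rfl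
    have h3 : (0 : SF I M) y = 0 := rfl
    rw [h3] at h1
    simp at h1
    linarith
  have hΘ {y : M} (hF : ∀ᶠ y in 𝓝 y, Orthonormal ℝ (fun i ↦ F i y)) {X : VF I M}
      (hX : (𝓚).Hor X) : (𝓚).Θ F (𝓚).T X y = 0 := by
    obtain ⟨Z, hZ⟩ := exists_f_f hS hX y
    rw [← Θ_congr_right hS _ hZ, Θ_vertical hS h hF (𝓚).f_T]
  have hF' := eventually_eventually_nhds.2 hF
  have key := (𝓚).ev_lie_T_Θ (orthonormalAt hF) (fun X hX ↦ hΘ hF hX)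
    (fun X Y hX ↦ by
      have h0 : dirDeriv Y ((𝓚).Θ F (𝓚).T X) x = dirDeriv Y 0 x :=
        dirDeriv_congr Y (hF'.mono fun y hy ↦ hΘ hy hX)
      refine Eq.trans h0 ?_
      rw [map_zero]; rfl) hX ((𝓚).hor_f Y)
  rw [KenmotsuAlgebra.br_T_f hw hY, map_sub, map_sub] at key
  have e1 : dirDeriv (𝓚).T (R X Y) x = dirDeriv (𝓚).T ((𝓚).Θ F X ((𝓚).f Y)) x :=
    dirDeriv_congr _ (hF'.mono fun y hy ↦ hR hy hX hY)
  have e2 := hR hF (hX.br_T hw) hY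
  have e3 := hR hF hX (hY.br_T hw)
  change dirDeriv (𝓚).T (R X Y) x - R ((𝓚).br (𝓚).T X) Y x - R X ((𝓚).br (𝓚).T Y) x = _
  rw [e1, e2, e3]
  refine Eq.trans key ?_
  rw [← evalAt_apply]
  simp only [map_mul, map_neg, map_ofNat]
  ring

include hS h in
theorem eq_zero (hn : 0 < n) (hs : 0 < s) (hβ : β ≠ 0) [Nonempty M] : l + m = 0 := by
  obtain ⟨x⟩ := ‹Nonempty M›
  obtain ⟨X, hX, hX'⟩ := exists_hor hS hn x
  have hN : (𝓚).N = algebraMap ℝ (SF I M) s := by simp [KenmotsuAlgebra.N]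
  have hT : (𝓚).g ((𝓚).nab (𝓚).T V) (𝓚).T = algebraMap ℝ (SF I M) ((l + m) * s ^ 2) := by
    ext x
    obtain ⟨F, hF⟩ := exists_orthonormal_frame (I := I) x
    have h1 := soliton_apply hS h hF (𝓚).T (𝓚).T
    have h2 : LeviCivitaAlgebra.lieG (K := lcAlgebra I M) V (𝓚).T (𝓚).T x =
      (𝓚).g ((𝓚).nab (𝓚).T V) (𝓚).T x + (𝓚).g ((𝓚).nab (𝓚).T V) (𝓚).T x := rfl
    have h3 : (𝓚).N x = s := by rw [hN]; rfl
    have h4 : (1 : SF I M) x = 1 := rfl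
    have h5 : (0 : SF I M) x = 0 := rfl
    rw [(𝓚).f_T, Θ_zero_right, (𝓚).g_T_T, h2, h3, h5] at h1
    simp only [(𝓚).g_T_ξ, h4] at h1
    simp at h1
    change _ = (l + m) * s ^ 2
    linarith
  have hTX (X : VF I M) (hX : (𝓚).Hor X) :
      (𝓚).g ((𝓚).nab (𝓚).T V) X + (𝓚).g ((𝓚).nab X V) (𝓚).T = 0 := by
    ext x
    obtain ⟨F, hF⟩ := exists_orthonormal_frame (I := I) x
    have h1 := soliton_apply hS h hF X (𝓚).T
    have h2 : LeviCivitaAlgebra.lieG (K := lcAlgebra I M) V X (𝓚).T x =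
      (𝓚).g ((𝓚).nab X V) (𝓚).T x + (𝓚).g ((𝓚).nab (𝓚).T V) X x := rfl
    have h5 : (0 : SF I M) x = 0 := rfl
    rw [(𝓚).f_T, Θ_zero_right, hX.T, h2, h5] at h1
    simp only [hX _, h5] at h1
    simp at h1
    change (𝓚).g ((𝓚).nab (𝓚).T V) X x + (𝓚).g ((𝓚).nab X V) (𝓚).T x = 0
    linarith
  have key := KenmotsuAlgebra.eq_zero_of_lie_T (r := algebraMap ℝ _ (2 * l))
    (hor_nab_T hS h hβ) (nab_T_T hS hn hβ) hT
    (fun X ↦ Derivation.map_algebraMap _ _) (fun X ↦ Derivation.map_algebraMap _ _) hTX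
    (fun X Y ↦ algebraMap ℝ _ (2 * l) * (𝓚).g X Y -
      LeviCivitaAlgebra.lieG (K := lcAlgebra I M) V X Y)
    (fun X Y _ _ ↦ (sub_sub_cancel _ _).symm)
    (fun X Y hX hY ↦ lie_T_ricci hS h hβ hX hY) hX
  have h1 := congrArg (evalAt I x) key
  rw [map_mul, map_mul, map_mul, map_zero, map_pow, hN] at h1
  have e1 : evalAt I x (𝓚).β = β := rfl
  have e2 (r : ℝ) : evalAt I x (algebraMap ℝ (SF I M) r) = r := rfl
  rw [e1, e2, e2] at h1
  have hs' : (s : ℝ) ≠ 0 := by exact_mod_cast hs.ne'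
  have h2 := (mul_eq_zero.1 h1).resolve_right hX'
  have h3 := (mul_eq_zero.1 h2).resolve_left (mul_ne_zero hs' (pow_ne_zero 2 hβ))
  exact (mul_eq_zero.1 h3).resolve_right (pow_ne_zero 2 hs')

end KenmotsuGeometry

end

end WeakKenmotsu

theorem proposition5 {n s : ℕ} (hn : 0 < n) (hs : 0 < s)
    {M : Type*} [TopologicalSpace M] [T2Space M] [SecondCountableTopology M] [Nonempty M]
    [ChartedSpace (EuclideanSpace ℝ (Fin (2 * n + s))) M] [IsManifold (𝓡 (2 * n + s)) ∞ M]
    [RiemannianBundle (fun x : M ↦ TangentSpace (𝓡 (2 * n + s)) x)]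
    [IsContMDiffRiemannianBundle (𝓡 (2 * n + s)) ∞ (EuclideanSpace ℝ (Fin (2 * n + s)))
      (fun x : M ↦ TangentSpace (𝓡 (2 * n + s)) x)]
    (S : WeakKenmotsu.WeakMetricFStructure (𝓡 (2 * n + s)) M n s)
    (β : ℝ) (hβ : β ≠ 0) (hS : S.IsWeakKenmotsu β)
    (V : Π x : M, TangentSpace (𝓡 (2 * n + s)) x) (hV : ContMDiff (𝓡 (2 * n + s)) (𝓡 (2 * n + s)).tangent ∞ (T% V))
    (l m : ℝ) (h : S.IsStarEtaRicciSoliton V l m) :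
    l + m = 0 :=
  WeakKenmotsu.KenmotsuGeometry.eq_zero (V := ⟨V, hV⟩) hS h hn hs hβ
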